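/- Let $H_0$ be the bounded selfadjoint operator on $\ell^2(\mathbb Z)$ given by $(H_0x)(n)=2x(n)-x(n+1)-x(n-1)$; its spectrum is $[0,4]$. Let $V$ be a bounded (not necessarily selfadjoint) operator on $\ell^2(\mathbb Z)$, let $V(n,m)=\langle e_n,Ve_m\rangle$ be its matrix entries in the canonical orthonormal basis $(e_n)_{n\in\mathbb Z}$, and assume that there are constants $C>0$ and $\delta>0$ such that $$|V(n,m)|\le C\,e^{-\delta(|n|+|m|)}\qquad\text{for all }(n,m)\in\mathbb Z^2 .$$ Put $H_V=H_0+V$. The discrete spectrum $\sigma_{\rm disc}(H_V)$ is the set of isolated points $z$ of the spectrum $\sigma(H_V)$ whose algebraic multiplicity, i.e. the rank of $\frac1{2\pi i}\oint_\gamma(H_V-\zeta)^{-1}\,d\zeta$ for a small circle $\gamma$ centred at $z$ that separates $z$ from the rest of $\sigma(H_V)$, is finite. Let $A_0=\mathcal F^{-1}\widehat A_0\mathcal F$, where $(\mathcal Fx)(\vartheta)=(2\pi)^{-1/2}\sum_{n\in\mathbb Z}e^{-in\vartheta}x(n)$ is the unitary Fourier transform from $\ell^2(\mathbb Z)$ onto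 $L^2(\mathbb T)$, $\mathbb T=\mathbb R/2\pi\mathbb Z$, and $\widehat A_0$ is the unique selfadjoint extension (the closure) of the operator $\sin\vartheta\,(-i\partial_\vartheta)+(-i\partial_\vartheta)\sin\vartheta$ with domain $C^\infty(\mathbb T)$. A vector $\varphi$ is analytic with respect to $A_0$ if it lies in the domain of $A_0^k$ for every $k\ge 0$ and $\sum_{k\ge0}\frac{t^k}{k!}\|A_0^k\varphi\|<\infty$ for some $t>0$. **Theorem.** The set $\sigma_{\rm disc}(H_V)$ has no limit point in $[0,4]$, hence is finite. Moreover, there is a finite set $\mathcal D\subset(0,4)$ with the following property: for every interval $\Delta_0$ that is relatively compact with $\overline{\Delta_0}\subset(0,4)\setminus\mathcal D$ there is $\delta_0>0$ such that every $z$ with $\operatorname{Re}z\in\Delta_0$ and $0<|\operatorname{Im}z|<\delta_0$ belongs to the resolvent set of $H_V$ and, for all vectors $\varphi,\psi$ analytic with respect to $A_0$, $$\sup_{\operatorname{Re}z\in\Delta_0,\ -\delta_0<\operatorname{Im}z<0}\bigl|\langle\varphi,(z-H_V)^{-1}\psi\rangle\bigr|<\infty,\qquad \sup_{\operatorname{Re}z\in\Delta_0,\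 0<\operatorname{Im}z<\delta_0}\bigl|\langle\varphi,(z-H_V)^{-1}\psi\rangle\bigr|<\infty .$$ -/

import Mathlib

open scoped ContDiff

noncomputable section

namespace DiscreteSchrodinger

/-! ## The Hilbert space and the operators `H₀`, `H_V` -/

/-- The Hilbert space `ℓ²(ℤ)`. -/
abbrev L2Z : Type := lp (fun _ : ℤ => ℂ) 2

/-- The canonical basis vector `e_n` of `ℓ²(ℤ)`. -/
def e (n : ℤ) : L2Z := lp.single 2 n (1 : ℂ)

lemma memlp_shift (k : ℤ) (x : L2Z) : Memℓp (fun n : ℤ => (x : ℤ → ℂ) (n + k)) 2 := by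
  have h := (memℓp_gen_iff (p := 2) (by norm_num)).1 (lp.memℓp x)
  refine (memℓp_gen_iff (p := 2) (by norm_num)).2 ?_
  exact (Equiv.addRight k).summable_iff.2 h

/-- The translation `(S_k x)(n) = x(n + k)` on `ℓ²(ℤ)`. -/
def shift (k : ℤ) : L2Z →ₗᵢ[ℂ] L2Z where
  toFun x := ⟨fun n : ℤ => (x : ℤ → ℂ) (n + k), memlp_shift k x⟩
  map_add' _ _ := rfl
  map_smul' _ _ := rfl
  norm_map' x := by
    have h2 : (0 : ℝ) < (2 : ENNReal).toReal := by norm_num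
    rw [lp.norm_eq_tsum_rpow h2, lp.norm_eq_tsum_rpow h2]
    congr 1
    exact (Equiv.addRight k).tsum_eq
      (fun n : ℤ => ‖(x : ℤ → ℂ) n‖ ^ (2 : ENNReal).toReal)

/-- The discrete Schrödinger operator `H₀`. -/
def H₀ : L2Z →L[ℂ] L2Z :=
  (2 : ℂ) • ContinuousLinearMap.id ℂ L2Z - (shift 1).toContinuousLinearMap
    - (shift (-1)).toContinuousLinearMap

lemma H₀_apply (x : L2Z) (n : ℤ) :
    (H₀ x : ℤ → ℂ) n
      = 2 * (x : ℤ → ℂ) n - (x : ℤ → ℂ) (n + 1) - (x : ℤ → ℂ) (n - 1) := rfl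

/-- The perturbed operator `H_V = H₀ + V`. -/
def H (V : L2Z →L[ℂ] L2Z) : L2Z →L[ℂ] L2Z := H₀ + V

/-- The entry `V(n, m)` of the matrix of `V` in the canonical basis. -/
def entry (V : L2Z →L[ℂ] L2Z) (n m : ℤ) : ℂ := inner ℂ (e n) (V (e m))

/-- Exponential decay of the matrix entries, in both indices. -/
def ExpDecay (V : L2Z →L[ℂ] L2Z) : Prop :=
  ∃ C : ℝ, 0 < C ∧ ∃ δ : ℝ, 0 < δ ∧
    ∀ n m : ℤ, ‖entry V n m‖ ≤ C * Real.exp (-δ * (|(n : ℝ)| + |(m : ℝ)|))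

/-! ## The discrete spectrum -/

section Spectrum

variable {E : Type*} [NormedAddCommGroup E] [NormedSpace ℂ E]

/-- `(2πi)⁻¹ ∮_{|ζ - z| = r} (L - ζ)⁻¹ dζ`. -/
def rieszIntegral (L : E →L[ℂ] E) (z : ℂ) (r : ℝ) : E →L[ℂ] E :=
  (2 * (Real.pi : ℂ) * Complex.I)⁻¹ • ∮ ζ in C(z, r),
    Ring.inverse (L - algebraMap ℂ (E →L[ℂ] E) ζ)

/-- The discrete spectrum: the isolated points of the spectrum of finite algebraic multiplicity,
the algebraic multiplicity being the rank of the Riesz integral over a circle which separates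
the point from the rest of the spectrum. -/
def discreteSpectrum (L : E →L[ℂ] E) : Set ℂ :=
  {z | z ∈ spectrum ℂ L ∧ ∃ r : ℝ, 0 < r ∧ spectrum ℂ L ∩ Metric.closedBall z r = {z} ∧
    FiniteDimensional ℂ (rieszIntegral L z r).range}

end Spectrum

/-! ## The conjugate operator `A₀` -/

instance factTwoPiPos : Fact (0 < 2 * Real.pi) := ⟨Real.two_pi_pos⟩

/-- The torus `ℝ / 2πℤ`. -/
abbrev Torus : Type := AddCircle (2 * Real.pi)

/-- `L²(𝕋)`, for the normalized measure `dϑ / 2π`. -/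
abbrev L2T : Type := MeasureTheory.Lp ℂ 2 (AddCircle.haarAddCircle (T := 2 * Real.pi))

/-- The Hilbert basis `ϑ ↦ exp(-inϑ)`, `n ∈ ℤ`, of `L²(𝕋)`. -/
def expBasis : HilbertBasis ℤ ℂ L2T :=
  HilbertBasis.mk (v := fun n : ℤ => fourierLp (T := 2 * Real.pi) 2 (-n))
    (orthonormal_fourier.comp (fun n : ℤ => -n) neg_injective) (by
      have h : Set.range (fun n : ℤ => fourierLp (T := 2 * Real.pi) 2 (-n))
          = Set.range (fourierLp (T := 2 * Real.pi) 2) :=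
        (Equiv.neg ℤ).surjective.range_comp (fourierLp (T := 2 * Real.pi) 2)
      rw [h]
      exact (span_fourierLp_closure_eq_top (by norm_num)).ge)

/-- The discrete Fourier transform `(ℱ x)(ϑ) = ∑ₙ exp(-inϑ) x(n)`, a unitary operator from
`ℓ²(ℤ)` onto `L²(𝕋, dϑ / 2π)`. -/
def fourierTransform : L2Z ≃ₗᵢ[ℂ] L2T := expBasis.repr.symm

/-- `C^∞(𝕋)`. -/
def smoothTorus : Submodule ℂ C(Torus, ℂ) where
  carrier := {f | ContDiff ℝ ∞ (fun t : ℝ => f (t : Torus))}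
  add_mem' {f g} hf hg := by
    have hf' : ContDiff ℝ ∞ (fun t : ℝ => f (t : Torus)) := hf
    exact hf'.add hg
  zero_mem' := by
    have h : ContDiff ℝ ∞ (fun _ : ℝ => (0 : ℂ)) := contDiff_const
    exact h
  smul_mem' c f hf := by
    have hf' : ContDiff ℝ ∞ (fun t : ℝ => f (t : Torus)) := hf
    exact hf'.const_smul c

lemma smoothTorus_contDiff (f : smoothTorus) :
    ContDiff ℝ ∞ (fun t : ℝ => f.1 (t : Torus)) := f.2

lemma smoothTorus_differentiable (f : smoothTorus) :
    Differentiable ℝ (fun t : ℝ => f.1 (t : Torus)) :=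
  (smoothTorus_contDiff f).differentiable (by simp)

lemma deriv_periodic (f : C(Torus, ℂ)) :
    Function.Periodic (deriv (fun t : ℝ => f (t : Torus))) (2 * Real.pi) := by
  intro t
  have h : (fun s : ℝ => f ((s + 2 * Real.pi : ℝ) : Torus)) = fun s : ℝ => f (s : Torus) := by
    funext s
    rw [AddCircle.coe_add_period]
  rw [← deriv_comp_add_const, h]

/-- The derivative `∂_ϑ` on `C^∞(𝕋)`. -/
def derivTorus : smoothTorus →ₗ[ℂ] smoothTorus where
  toFun f :=
    ⟨⟨(deriv_periodic f.1).lift, continuous_coinduced_dom.2 ((smoothTorus_contDiff f).continuous_deriv (by simp))⟩,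
      (contDiff_infty_iff_deriv.1 (smoothTorus_contDiff f)).2⟩
  map_add' f g := by
    apply Subtype.ext
    ext x
    induction x using QuotientAddGroup.induction_on with
    | H t =>
      exact deriv_fun_add (smoothTorus_differentiable f t) (smoothTorus_differentiable g t)
  map_smul' c f := by
    apply Subtype.ext
    ext x
    induction x using QuotientAddGroup.induction_on with
    | H t =>
      exact deriv_fun_const_smul c (smoothTorus_differentiable f t)

lemma derivTorus_apply (f : smoothTorus) (t : ℝ) :
    (derivTorus f).1 (t : Torus) = deriv (fun s : ℝ => f.1 (s : Torus)) t := rfl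

/-- The function `sin` on the torus. -/
def sinTorus : C(Torus, ℂ) where
  toFun := Function.Periodic.lift (f := fun t : ℝ => (Real.sin t : ℂ)) (c := 2 * Real.pi)
    (fun t => by simp only [Real.sin_add_two_pi])
  continuous_toFun := continuous_coinduced_dom.2
    (Complex.continuous_ofReal.comp Real.continuous_sin)

lemma sinTorus_apply (t : ℝ) : sinTorus (t : Torus) = (Real.sin t : ℂ) := rfl

/-- Multiplication by `sin ϑ` on `C^∞(𝕋)`. -/
def mulSin : smoothTorus →ₗ[ℂ] smoothTorus where
  toFun f := ⟨sinTorus * f.1,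
    (Complex.ofRealCLM.contDiff.comp Real.contDiff_sin).mul (smoothTorus_contDiff f)⟩
  map_add' _ _ := Subtype.ext (mul_add _ _ _)
  map_smul' c f := Subtype.ext (mul_smul_comm c sinTorus f.1)

/-- The symmetric operator `sin ϑ (-i∂_ϑ) + (-i∂_ϑ) sin ϑ` on `C^∞(𝕋)`. -/
def dilation : smoothTorus →ₗ[ℂ] smoothTorus :=
  mulSin ∘ₗ (-Complex.I • derivTorus) + (-Complex.I • derivTorus) ∘ₗ mulSin

/-- The inclusion `C^∞(𝕋) → L²(𝕋)`. -/
def smoothToL2 : smoothTorus →ₗ[ℂ] L2T :=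
  (ContinuousMap.toLp (E := ℂ) 2 (AddCircle.haarAddCircle (T := 2 * Real.pi)) ℂ).toLinearMap
    ∘ₗ smoothTorus.subtype

instance haarOpenPos : (AddCircle.haarAddCircle (T := 2 * Real.pi)).IsOpenPosMeasure := by
  unfold AddCircle.haarAddCircle
  infer_instance

lemma smoothToL2_injective : Function.Injective smoothToL2 :=
  (ContinuousMap.toLp_injective (AddCircle.haarAddCircle (T := 2 * Real.pi))).comp
    Subtype.val_injective

/-- `sin ϑ (-i∂_ϑ) + (-i∂_ϑ) sin ϑ` as an unbounded operator on `L²(𝕋)` with domain `C^∞(𝕋)`. -/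
def AhatMin : L2T →ₗ.[ℂ] L2T where
  domain := smoothToL2.range
  toFun := smoothToL2 ∘ₗ dilation ∘ₗ
    (LinearEquiv.ofInjective smoothToL2 smoothToL2_injective).symm.toLinearMap

lemma AhatMin_apply (f : smoothTorus) (h : smoothToL2 f ∈ AhatMin.domain) :
    AhatMin ⟨smoothToL2 f, h⟩ = smoothToL2 (dilation f) := by
  change smoothToL2 (dilation ((LinearEquiv.ofInjective smoothToL2 smoothToL2_injective).symm
    ⟨smoothToL2 f, h⟩)) = _
  congr 2
  rw [LinearEquiv.symm_apply_eq]
  rfl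

lemma dense_domain_AhatMin : Dense (AhatMin.domain : Set L2T) := by
  have h : Submodule.span ℂ (Set.range (fourierLp (T := 2 * Real.pi) 2)) ≤ AhatMin.domain := by
    rw [Submodule.span_le]
    rintro _ ⟨n, rfl⟩
    have hs : ContDiff ℝ ∞
        (fun t : ℝ => fourier (T := 2 * Real.pi) n (t : Torus)) := by
      simp only [fourier_coe_apply]
      have hr : ContDiff ℝ ∞ (fun t : ℝ => (t : ℂ)) := Complex.ofRealCLM.contDiff
      exact ((contDiff_const.mul hr).div_const _).cexp
    exact ⟨⟨fourier n, hs⟩, rfl⟩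
  rw [dense_iff_closure_eq, ← Submodule.topologicalClosure_coe]
  have h2 := Submodule.topologicalClosure_mono h
  rw [span_fourierLp_closure_eq_top (by norm_num), top_le_iff] at h2
  rw [h2]
  rfl

lemma integral_derivTorus (f : smoothTorus) :
    ∫ x, (derivTorus f).1 x ∂(AddCircle.haarAddCircle (T := 2 * Real.pi)) = 0 := by
  rw [AddCircle.integral_haarAddCircle, ← AddCircle.intervalIntegral_preimage (2 * Real.pi) 0]
  simp only [derivTorus_apply]
  rw [intervalIntegral.integral_deriv_eq_sub
    (fun t _ => smoothTorus_differentiable f t)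
    (((smoothTorus_contDiff f).continuous_deriv (by simp)).intervalIntegrable _ _)]
  rw [AddCircle.coe_add_period]
  simp

lemma AhatMin_symmetric : AhatMin.IsFormalAdjoint AhatMin := by
  rintro ⟨_, f, rfl⟩ ⟨_, g, rfl⟩
  have ef := AhatMin_apply f ⟨f, rfl⟩
  have eg := AhatMin_apply g ⟨g, rfl⟩
  refine (congrArg (fun u : L2T => inner ℂ u (smoothToL2 g)) ef).trans
    (Eq.trans ?_ (congrArg (fun u : L2T => inner ℂ (smoothToL2 f) u) eg).symm)
  change inner ℂ (ContinuousMap.toLp 2 _ ℂ (dilation f).1) (ContinuousMap.toLp 2 _ ℂ g.1)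
    = inner ℂ (ContinuousMap.toLp 2 _ ℂ f.1) (ContinuousMap.toLp 2 _ ℂ (dilation g).1)
  rw [MeasureTheory.ContinuousMap.inner_toLp, MeasureTheory.ContinuousMap.inner_toLp, ← sub_eq_zero]
  have hi : ∀ u v : C(Torus, ℂ), MeasureTheory.Integrable
      (fun x => u x * (starRingEnd ℂ) (v x)) (AddCircle.haarAddCircle (T := 2 * Real.pi)) := by
    intro u v
    have hc : Continuous fun x => u x * (starRingEnd ℂ) (v x) := by fun_prop
    exact hc.integrable_of_hasCompactSupport (HasCompactSupport.of_compactSpace _)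
  rw [← MeasureTheory.integral_sub (hi _ _) (hi _ _)]
  have hd : ∀ (k : smoothTorus) (t : ℝ), HasDerivAt (fun s : ℝ => k.1 (s : Torus))
      ((derivTorus k).1 (t : Torus)) t := fun k t =>
    (smoothTorus_differentiable k t).hasDerivAt
  have hsin : ∀ t : ℝ, HasDerivAt (fun s : ℝ => (Real.sin s : ℂ)) (Real.cos t : ℂ) t :=
    fun t => (Real.hasDerivAt_sin t).ofReal_comp
  have hconj : ContDiff ℝ ∞ (fun t : ℝ => (starRingEnd ℂ) (f.1 (t : Torus))) :=
    Complex.conjCLE.contDiff.comp (smoothTorus_contDiff f)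
  let h : smoothTorus := ⟨sinTorus * (star f.1 * g.1),
    ((Complex.ofRealCLM.contDiff.comp Real.contDiff_sin).mul
      (hconj.mul (smoothTorus_contDiff g)))⟩
  have key : ∀ x : Torus,
      g.1 x * (starRingEnd ℂ) ((dilation f).1 x) - (dilation g).1 x * (starRingEnd ℂ) (f.1 x)
        = (2 * Complex.I) * (derivTorus h).1 x := by
    intro x
    induction x using QuotientAddGroup.induction_on with
    | H t =>
      have e1 : ∀ k : smoothTorus, (dilation k).1 (t : Torus)
          = (Real.sin t : ℂ) * (-Complex.I * (derivTorus k).1 (t : Torus))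
            + -Complex.I * ((Real.cos t : ℂ) * k.1 (t : Torus)
              + (Real.sin t : ℂ) * (derivTorus k).1 (t : Torus)) := by
        intro k
        have e2 : (derivTorus (mulSin k)).1 (t : Torus)
            = (Real.cos t : ℂ) * k.1 (t : Torus)
              + (Real.sin t : ℂ) * (derivTorus k).1 (t : Torus) :=
          ((hsin t).mul (hd k t)).deriv
        rw [← e2]
        rfl
      have hc : HasDerivAt (fun s : ℝ => (starRingEnd ℂ) (f.1 (s : Torus)))
          ((starRingEnd ℂ) ((derivTorus f).1 (t : Torus))) t :=
        (Complex.conjCLE : ℂ →L[ℝ] ℂ).hasFDerivAt.comp_hasDerivAt t (hd f t)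
      have e3 : (derivTorus h).1 (t : Torus)
          = (Real.cos t : ℂ) * ((starRingEnd ℂ) (f.1 (t : Torus)) * g.1 (t : Torus))
            + (Real.sin t : ℂ) * ((starRingEnd ℂ) ((derivTorus f).1 (t : Torus)) * g.1 (t : Torus)
              + (starRingEnd ℂ) (f.1 (t : Torus)) * (derivTorus g).1 (t : Torus)) :=
        ((hsin t).mul (hc.mul (hd g t))).deriv
      have e4 := e1 f
      have e5 := e1 g
      change g.1 (t : Torus) * (starRingEnd ℂ) ((dilation f).1 (t : Torus))
        - (dilation g).1 (t : Torus) * (starRingEnd ℂ) (f.1 (t : Torus))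
        = (2 * Complex.I) * (derivTorus h).1 (t : Torus)
      rw [e3, e4, e5]
      simp only [map_add, map_mul, map_neg, Complex.conj_I, Complex.conj_ofReal]
      ring
  simp_rw [key]
  rw [MeasureTheory.integral_const_mul, integral_derivTorus, mul_zero]

/-- The symmetric operator is closable, so that its closure is a genuine closed operator. -/
lemma AhatMin_isClosable : AhatMin.IsClosable :=
  (LinearPMap.adjoint_isClosed dense_domain_AhatMin).isClosable.leIsClosable
    (AhatMin_symmetric.le_adjoint dense_domain_AhatMin)

/-- The selfadjoint operator `Â₀` on `L²(𝕋)`: the unique selfadjoint extension of the essentially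
selfadjoint operator `AhatMin`, that is, its closure. -/
def Ahat : L2T →ₗ.[ℂ] L2T := AhatMin.closure

/-- The conjugate operator `A₀ = ℱ⁻¹ Â₀ ℱ` on `ℓ²(ℤ)`, with domain `ℱ⁻¹ D(Â₀)`. -/
def A₀ : L2Z →ₗ.[ℂ] L2Z where
  domain := Ahat.domain.comap fourierTransform.toLinearEquiv.toLinearMap
  toFun := fourierTransform.symm.toLinearEquiv.toLinearMap ∘ₗ Ahat.toFun ∘ₗ
    fourierTransform.toLinearEquiv.toLinearMap.restrict (fun _ hx => hx)

/-- `φ` is an analytic vector for the operator `A`: all the `A^k φ` are defined (they are the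
terms `u k`), and `∑ₖ t^k ‖A^k φ‖ / k!` converges for some `t > 0`. -/
def IsAnalyticVector {E : Type*} [NormedAddCommGroup E] [NormedSpace ℂ E] (A : E →ₗ.[ℂ] E)
    (φ : E) : Prop :=
  ∃ u : ℕ → E, u 0 = φ ∧ (∀ k, (u k, u (k + 1)) ∈ A.graph) ∧
    ∃ t : ℝ, 0 < t ∧ Summable (fun k : ℕ => t ^ k / (k.factorial : ℝ) * ‖u k‖)

end DiscreteSchrodinger

end

/-!
The proof combines an analytic Fredholm argument for the discrete spectrum with a commutator form
of the limiting absorption principle for `H₀`.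

*Reduction to a compact analytic family.* The decay of `V` gives a factorization `V = W K W`, with
`W` the multiplication by `s ^ (2|n|)`, `s < 1`, and `K` an operator with absolutely summable
kernel (`ExpDecay.exists_factorization`). The complement of `[0, 4]` is the image of the punctured
unit disc under `z = 2 - w - w⁻¹`, and the Green function of `H₀` is there
`w / (1 - w²) * w ^ |n - m|`. Hence `T(w) = W (H₀ - z)⁻¹ W` continues to the larger disc
`|w| < s⁻¹`: splitting `w ^ |n - m|` into its Dirichlet part and `w ^ (|n| + |m|)` shows that it is
the sum of an analytic family of operators and of a rank one term with poles only at `w = ±1`, that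
is, at the thresholds `0` and `4`. Then `z` is in the resolvent set of `H_V` as soon as `1 + K T(w)`
is invertible, and the resolvent of `H_V` is expressed through the free one and `(1 + K T(w))⁻¹`
(`resolvent_H_eq`).

*Discrete spectrum.* Truncating `K` to finite rank reduces the invertibility of `1 + K T(w)` to the
nonvanishing of a finite determinant; clearing the pole at `±1` from one row makes it holomorphic in
`|w| < s⁻¹`, and it equals `1` at `w = 0` (`exists_determinant`). It has finitely many zeros in the
closed unit disc, so that `H_V` has only finitely many spectral points off `[0, 4]`. As `[0, 4]` is
contained in the spectrum of `H_V` (`Icc_subset_spectrum_H`), no point of it is isolated.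

*Limiting absorption.* With `Q = (z - H₀)⁻¹`, the commutator of `A₀` with `Q` is
`-i (z (4 - z) Q² - (4 - 2 z) Q - 1)` (`commutator_resolvent`). Since `dQ/dz = -Q²`, this bounds the
derivative of `⟨x, Q y⟩` by the matrix elements of `Q` itself between `x`, `y`, `A₀ x`, `A₀ y`, away
from the thresholds. Two integrations of this differential inequality improve the trivial bound
`|Im z|⁻¹` first to `|Im z|^(-1/2)` and then to a constant, for `x` and `y` in the domain of `A₀²`
(`limiting_absorption_H₀`). The basis vectors belong to this domain with polynomially growing graph
norms, so `W Q y` is bounded as well (`limiting_absorption_weight`).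

*Conclusion.* The exceptional set consists of the points `2 - 2 Re w`, for the zeros `w` of the
determinant on the unit circle. Away from it `(1 + K T(w))⁻¹` is bounded up to the circle, by
compactness (`exists_uniform_bound_inverse`), and the resolvent formula gives the bound for `H_V`.
-/

noncomputable section

namespace DiscreteSchrodinger

open InnerProductSpace Filter Topology

/-! ### Operators with absolutely summable kernels -/

lemma inner_e_left (n : ℤ) (x : L2Z) : inner ℂ (e n) x = (x : ℤ → ℂ) n := by
  simp [e, lp.inner_single_left]

lemma e_apply (n m : ℤ) : (e n : ℤ → ℂ) m = if m = n then 1 else 0 := by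
  by_cases h : m = n
  · subst h; simp [e]
  · simp [e, h]

lemma norm_e (n : ℤ) : ‖e n‖ = 1 := by
  simp [e, lp.norm_single]

lemma hasSum_e (x : L2Z) : HasSum (fun n : ℤ => (x : ℤ → ℂ) n • e n) x := by
  convert! lp.hasSum_single (p := 2) (by norm_num) x using 2 with n
  rw [e, ← lp.single_smul, smul_eq_mul, mul_one]

lemma entry_eq_apply (A : L2Z →L[ℂ] L2Z) (n m : ℤ) : entry A n m = (A (e m) : ℤ → ℂ) n :=
  inner_e_left _ _

lemma ext_e {F : Type*} [NormedAddCommGroup F] [NormedSpace ℂ F] {A B : L2Z →L[ℂ] F}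
    (h : ∀ m, A (e m) = B (e m)) : A = B := by
  ext1 x
  have hA := (hasSum_e x).mapL A
  have hB := (hasSum_e x).mapL B
  simp only [map_smul, h] at hA hB
  exact hA.unique hB

lemma ext_entry {A B : L2Z →L[ℂ] L2Z} (h : ∀ n m, entry A n m = entry B n m) : A = B := by
  refine ext_e fun m => lp.ext (funext fun n => ?_)
  rw [← entry_eq_apply, ← entry_eq_apply, h]

/-- The operator with matrix entries `a (n, m)`, as a norm convergent sum of rank one operators.
It is meaningful when `a` is absolutely summable. -/
def kernelOp (a : ℤ × ℤ → ℂ) : L2Z →L[ℂ] L2Z :=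
  ∑' p : ℤ × ℤ, a p • rankOne ℂ (e p.1) (e p.2)

lemma norm_smul_rankOne_e (c : ℂ) (n m : ℤ) : ‖c • rankOne ℂ (e n) (e m)‖ = ‖c‖ := by
  rw [norm_smul, norm_rankOne, norm_e, norm_e, mul_one, mul_one]

lemma hasSum_kernelOp {a : ℤ × ℤ → ℂ} (ha : Summable fun p => ‖a p‖) :
    HasSum (fun p : ℤ × ℤ => a p • rankOne ℂ (e p.1) (e p.2)) (kernelOp a) := by
  refine Summable.hasSum (Summable.of_norm ?_)
  simpa only [norm_smul_rankOne_e] using ha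

lemma norm_kernelOp_le {a : ℤ × ℤ → ℂ} (ha : Summable fun p => ‖a p‖) :
    ‖kernelOp a‖ ≤ ∑' p, ‖a p‖ := by
  refine (norm_tsum_le_tsum_norm ?_).trans_eq ?_ <;> simp only [norm_smul_rankOne_e]
  exact ha

lemma entry_kernelOp {a : ℤ × ℤ → ℂ} (ha : Summable fun p => ‖a p‖) (n m : ℤ) :
    entry (kernelOp a) n m = a (n, m) := by
  have h := ((hasSum_kernelOp ha).mapL
    ((innerSL ℂ (e n)).comp (ContinuousLinearMap.apply ℂ L2Z (e m))))
  refine h.unique ?_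
  convert! hasSum_ite_eq (n, m) (a (n, m)) using 1
  funext p
  obtain ⟨i, j⟩ := p
  simp only [ContinuousLinearMap.comp_apply, ContinuousLinearMap.apply_apply,
    smul_apply, rankOne_apply, innerSL_apply_apply, inner_smul_right,
    inner_e_left, e_apply, Prod.mk.injEq]
  by_cases h1 : i = n <;> by_cases h2 : j = m <;> simp [h1, h2, eq_comm]
  all_goals tauto

lemma differentiableOn_kernelOp {U : Set ℂ} (hU : IsOpen U) {a : ℂ → ℤ × ℤ → ℂ} {u : ℤ × ℤ → ℝ}
    (hu : Summable u) (hd : ∀ p, DifferentiableOn ℂ (fun w => a w p) U)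
    (hb : ∀ p, ∀ w ∈ U, ‖a w p‖ ≤ u p) : DifferentiableOn ℂ (fun w => kernelOp (a w)) U := by
  refine Complex.differentiableOn_tsum_of_summable_norm hu
    (fun p => (hd p).smul_const _) hU fun p w hw => ?_
  rw [norm_smul_rankOne_e]
  exact hb p w hw

/-! ### Exponential weights -/

lemma summable_pow_natAbs {q : ℝ} (h0 : 0 ≤ q) (h1 : q < 1) (k : ℕ) :
    Summable fun n : ℤ => (n.natAbs : ℝ) ^ k * q ^ n.natAbs := by
  have h := summable_pow_mul_geometric_of_norm_lt_one (R := ℝ) k (r := q)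
    (by rwa [Real.norm_of_nonneg h0])
  refine Summable.of_nat_of_neg ?_ ?_ <;> simpa using h

lemma summable_geom_natAbs {q : ℝ} (h0 : 0 ≤ q) (h1 : q < 1) :
    Summable fun n : ℤ => q ^ n.natAbs := by
  simpa using summable_pow_natAbs h0 h1 0

lemma summable_geom_prod {q : ℝ} (h0 : 0 ≤ q) (h1 : q < 1) :
    Summable fun p : ℤ × ℤ => q ^ (p.1.natAbs + p.2.natAbs) := by
  simpa only [pow_add] using (summable_geom_natAbs h0 h1).mul_of_nonneg
    (summable_geom_natAbs h0 h1) (fun _ => by positivity) (fun _ => by positivity)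

lemma summable_natAbs_geom_prod {q : ℝ} (h0 : 0 ≤ q) (h1 : q < 1) :
    Summable fun p : ℤ × ℤ => (p.1.natAbs : ℝ) * q ^ (p.1.natAbs + p.2.natAbs) := by
  have h := (summable_pow_natAbs h0 h1 1).mul_of_nonneg
    (summable_geom_natAbs h0 h1) (fun _ => by positivity) (fun _ => by positivity)
  simpa only [pow_add, pow_one, mul_assoc] using h

/-- The multiplication operator by the weight `n ↦ q ^ |n|`, for `0 ≤ q < 1`. -/
def weight (q : ℝ) : L2Z →L[ℂ] L2Z :=
  ∑' n : ℤ, ((q : ℂ) ^ n.natAbs) • rankOne ℂ (e n) (e n)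

lemma hasSum_weight_apply {q : ℝ} (h0 : 0 ≤ q) (h1 : q < 1) (x : L2Z) :
    HasSum (fun n : ℤ => ((q : ℂ) ^ n.natAbs * (x : ℤ → ℂ) n) • e n) (weight q x) := by
  have h : HasSum (fun n : ℤ => ((q : ℂ) ^ n.natAbs) • rankOne ℂ (e n) (e n)) (weight q) := by
    refine Summable.hasSum (Summable.of_norm ?_)
    simpa only [norm_smul_rankOne_e, norm_pow, Complex.norm_real, Real.norm_of_nonneg h0]
      using summable_geom_natAbs h0 h1
  have h2 := h.mapL (ContinuousLinearMap.apply ℂ L2Z x)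
  simpa only [ContinuousLinearMap.apply_apply,
    smul_apply, rankOne_apply, inner_e_left, smul_smul] using h2

lemma weight_e {q : ℝ} (h0 : 0 ≤ q) (h1 : q < 1) (m : ℤ) :
    weight q (e m) = ((q : ℂ) ^ m.natAbs) • e m := by
  refine (hasSum_weight_apply h0 h1 (e m)).unique ?_
  convert! hasSum_ite_eq m (((q : ℂ) ^ m.natAbs) • e m) using 1
  funext n
  by_cases h : n = m
  · subst h; simp [e_apply]
  · simp [e_apply, h]

lemma weight_apply {q : ℝ} (h0 : 0 ≤ q) (h1 : q < 1) (x : L2Z) (n : ℤ) :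
    (weight q x : ℤ → ℂ) n = (q : ℂ) ^ n.natAbs * (x : ℤ → ℂ) n := by
  have h := (hasSum_weight_apply h0 h1 x).mapL (innerSL ℂ (e n))
  rw [innerSL_apply_apply, inner_e_left] at h
  refine h.unique ?_
  convert! hasSum_ite_eq n ((q : ℂ) ^ n.natAbs * (x : ℤ → ℂ) n) using 1
  funext m
  rw [innerSL_apply_apply, inner_e_left]
  by_cases h : m = n
  · subst h; simp [e_apply]
  · simp [e_apply, h, Ne.symm h]

lemma norm_weight_apply_le {q : ℝ} (h0 : 0 ≤ q) (h1 : q < 1) (x : L2Z) {b : ℤ → ℝ}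
    (hb : Summable fun n : ℤ => q ^ n.natAbs * b n) (hx : ∀ n, ‖(x : ℤ → ℂ) n‖ ≤ b n) :
    ‖weight q x‖ ≤ ∑' n : ℤ, q ^ n.natAbs * b n := by
  rw [← (hasSum_weight_apply h0 h1 x).tsum_eq]
  refine tsum_of_norm_bounded hb.hasSum fun n => ?_
  rw [norm_smul, norm_e, mul_one, norm_mul, norm_pow, Complex.norm_real, Real.norm_of_nonneg h0]
  exact mul_le_mul_of_nonneg_left (hx n) (by positivity)

lemma entry_weight_mul_mul {q : ℝ} (h0 : 0 ≤ q) (h1 : q < 1) (A : L2Z →L[ℂ] L2Z) (n m : ℤ) :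
    entry (weight q * A * weight q) n m = (q : ℂ) ^ (n.natAbs + m.natAbs) * entry A n m := by
  simp only [entry_eq_apply, mul_apply_eq_comp, weight_e h0 h1, map_smul,
    lp.coeFn_smul, Pi.smul_apply, weight_apply h0 h1, smul_eq_mul]
  ring

/-- An exponentially decaying perturbation factors as `W K W`, with `W` an exponentially decaying
weight and `K` an operator with absolutely summable kernel. -/
lemma ExpDecay.exists_factorization {V : L2Z →L[ℂ] L2Z} (hV : ExpDecay V) :
    ∃ s : ℝ, 0 < s ∧ s < 1 ∧ ∃ k : ℤ × ℤ → ℂ, (Summable fun p => ‖k p‖) ∧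
      V = weight (s ^ 2) * kernelOp k * weight (s ^ 2) := by
  obtain ⟨C, hC, δ, hδ, h⟩ := hV
  -- the decay rate `exp (-δ) = s ^ 4` is shared equally between the two weights and `K`
  set s := Real.exp (-δ / 4) with hs
  have hs0 : 0 < s := Real.exp_pos _
  have hs1 : s < 1 := by rw [hs, Real.exp_lt_one_iff]; linarith
  have hq0 : (0 : ℝ) ≤ s ^ 2 := by positivity
  have hq1 : s ^ 2 < 1 := pow_lt_one₀ hs0.le hs1 two_ne_zero
  have hsC : (s : ℂ) ≠ 0 := by exact_mod_cast hs0.ne'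
  have he : ∀ n m : ℤ, Real.exp (-δ * (|(n : ℝ)| + |(m : ℝ)|))
      = ((s ^ 2) ^ (n.natAbs + m.natAbs)) ^ 2 := by
    intro n m
    rw [hs, ← Real.exp_nat_mul, ← Real.exp_nat_mul, ← Real.exp_nat_mul]
    congr 1
    push_cast
    rw [Nat.cast_natAbs, Nat.cast_natAbs]
    push_cast
    ring
  have hk : Summable fun p : ℤ × ℤ =>
      ‖entry V p.1 p.2 / ((s ^ 2 : ℝ) : ℂ) ^ (p.1.natAbs + p.2.natAbs)‖ := by
    refine Summable.of_nonneg_of_le (fun _ => norm_nonneg _) (fun p => ?_)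
      ((summable_geom_prod hq0 hq1).mul_left C)
    rw [norm_div, norm_pow, Complex.norm_real, Real.norm_of_nonneg hq0, div_le_iff₀ (by positivity)]
    refine (h _ _).trans_eq ?_
    rw [he]
    ring
  refine ⟨s, hs0, hs1, _, hk, ext_entry fun n m => ?_⟩
  rw [entry_weight_mul_mul hq0 hq1, entry_kernelOp hk]
  push_cast
  field_simp

/-! ### Translations -/

lemma shift_apply (k : ℤ) (x : L2Z) (n : ℤ) : (shift k x : ℤ → ℂ) n = (x : ℤ → ℂ) (n + k) := rfl

lemma H₀_shift (k : ℤ) (x : L2Z) : H₀ (shift k x) = shift k (H₀ x) := by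
  refine lp.ext (funext fun n => ?_)
  simp only [H₀_apply, shift_apply]
  ring_nf

lemma norm_coord_le (x : L2Z) (n : ℤ) : ‖(x : ℤ → ℂ) n‖ ≤ ‖x‖ :=
  lp.norm_apply_le_norm (by norm_num) x n

lemma tendsto_coord_cofinite (x : L2Z) :
    Tendsto (fun n : ℤ => ‖(x : ℤ → ℂ) n‖) cofinite (𝓝 0) := by
  have h := (hasSum_e x).summable.tendsto_cofinite_zero.norm
  simpa only [norm_smul, norm_e, mul_one, norm_zero] using h

lemma tendsto_weight_shift {q : ℝ} (h0 : 0 ≤ q) (h1 : q < 1) (x : L2Z) :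
    Tendsto (fun k : ℤ => weight q (shift k x)) cofinite (𝓝 0) := by
  have hs := summable_geom_natAbs h0 h1
  have hlim : Tendsto (fun k : ℤ => ∑' n : ℤ, q ^ n.natAbs * ‖(x : ℤ → ℂ) (n + k)‖) cofinite
      (𝓝 (∑' _ : ℤ, (0 : ℝ))) := by
    refine tendsto_tsum_of_dominated_convergence (hs.mul_right ‖x‖) (fun n => ?_)
      (Eventually.of_forall fun k n => ?_)
    · have h := ((tendsto_coord_cofinite x).comp
        (add_right_injective n).tendsto_cofinite).const_mul (q ^ n.natAbs)
      simpa using h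
    · rw [Real.norm_of_nonneg (by positivity)]
      exact mul_le_mul_of_nonneg_left (norm_coord_le x _) (by positivity)
  rw [tsum_zero] at hlim
  refine squeeze_zero_norm (fun k => ?_) hlim
  refine norm_weight_apply_le h0 h1 _ ?_ fun n => (le_of_eq (by rw [shift_apply]))
  refine Summable.of_nonneg_of_le (fun n => by positivity) (fun n => ?_) (hs.mul_right ‖x‖)
  exact mul_le_mul_of_nonneg_left (norm_coord_le x _) (by positivity)

/-! ### The free resolvent -/

/-- The parametrization `z = 2 - w - w⁻¹` of the complement of `[0, 4]` by the punctured unit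
disc. -/
def joukowski (w : ℂ) : ℂ := 2 - w - w⁻¹

lemma joukowski_eq_of_norm_eq_one {w : ℂ} (hw : ‖w‖ = 1) :
    joukowski w = ((2 - 2 * w.re : ℝ) : ℂ) := by
  have h : w⁻¹ = (starRingEnd ℂ) w := Complex.inv_eq_conj hw
  rw [joukowski, h, sub_sub, Complex.add_conj]
  push_cast
  ring

lemma exists_joukowski_eq (z : ℂ) : ∃ w : ℂ, w ≠ 0 ∧ ‖w‖ ≤ 1 ∧ joukowski w = z := by
  obtain ⟨d, hd⟩ := IsAlgClosed.exists_pow_nat_eq ((2 - z) ^ 2 - 4) two_pos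
  have key : ((2 - z + d) / 2) * ((2 - z - d) / 2) = 1 := by linear_combination -hd / 4
  have h0 : (2 - z + d) / 2 ≠ 0 := left_ne_zero_of_mul_eq_one key
  have hinv : ((2 - z + d) / 2)⁻¹ = (2 - z - d) / 2 := inv_eq_of_mul_eq_one_right key
  rcases le_total ‖(2 - z + d) / 2‖ 1 with h | h
  · refine ⟨_, h0, h, ?_⟩
    rw [joukowski, hinv]; ring
  · refine ⟨_, inv_ne_zero h0, ?_, ?_⟩
    · rw [norm_inv]; exact inv_le_one_of_one_le₀ h
    · rw [joukowski, inv_inv, hinv]; ring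

lemma exists_joukowski_eq_of_mem_Icc {x : ℝ} (hx : x ∈ Set.Icc (0 : ℝ) 4) :
    ∃ w : ℂ, ‖w‖ = 1 ∧ joukowski w = x := by
  have h : (1 - x / 2) ^ 2 ≤ 1 := by nlinarith [hx.1, hx.2]
  refine ⟨⟨1 - x / 2, Real.sqrt (1 - (1 - x / 2) ^ 2)⟩, ?_, ?_⟩
  · rw [Complex.norm_def, Complex.normSq_mk, Real.mul_self_sqrt (by linarith),
      Real.sqrt_eq_one]
    ring
  · rw [joukowski_eq_of_norm_eq_one]
    · push_cast; ring
    · rw [Complex.norm_def, Complex.normSq_mk, Real.mul_self_sqrt (by linarith),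
        Real.sqrt_eq_one]
      ring

/-- Off `[0, 4]` the operator `z - H₀` factors into two Neumann-invertible factors. -/
lemma isUnit_sub_H₀ {w : ℂ} (h0 : w ≠ 0) (h1 : ‖w‖ < 1) :
    IsUnit (algebraMap ℂ (L2Z →L[ℂ] L2Z) (joukowski w) - H₀) := by
  have hn : ∀ k : ℤ, IsUnit (1 - w • (shift k).toContinuousLinearMap : L2Z →L[ℂ] L2Z) := by
    intro k
    refine isUnit_one_sub_of_norm_lt_one ?_
    rw [norm_smul]
    exact (mul_le_of_le_one_right (norm_nonneg _)
      (LinearIsometry.norm_toContinuousLinearMap_le _)).trans_lt h1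
  have hu : IsUnit (algebraMap ℂ (L2Z →L[ℂ] L2Z) (-w⁻¹)) :=
    (isUnit_iff_ne_zero.2 (neg_ne_zero.2 (inv_ne_zero h0))).map _
  convert! hu.mul ((hn 1).mul (hn (-1))) using 1
  ext x n
  simp only [Algebra.algebraMap_eq_smul_one, mul_apply_eq_comp, sub_apply, smul_apply,
    one_apply_eq_self, lp.coeFn_sub, lp.coeFn_smul, Pi.sub_apply, Pi.smul_apply, H₀_apply,
    LinearIsometry.coe_toContinuousLinearMap, shift_apply, smul_eq_mul, joukowski, map_sub,
    map_smul]
  field_simp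
  ring_nf

/-- The vector `n ↦ w ^ |n|`, for `|w| < 1`. -/
def geomVec (w : ℂ) : L2Z := ∑' n : ℤ, w ^ n.natAbs • e n

lemma geomVec_apply {w : ℂ} (h1 : ‖w‖ < 1) (n : ℤ) :
    (geomVec w : ℤ → ℂ) n = w ^ n.natAbs := by
  have hs : HasSum (fun n : ℤ => w ^ n.natAbs • e n) (geomVec w) := by
    refine Summable.hasSum (Summable.of_norm ?_)
    simpa only [norm_smul, norm_e, mul_one, norm_pow] using
      summable_geom_natAbs (norm_nonneg w) h1
  have h := hs.mapL (innerSL ℂ (e n))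
  rw [innerSL_apply_apply, inner_e_left] at h
  refine h.unique ?_
  convert! hasSum_ite_eq n (w ^ n.natAbs) using 1
  funext m
  rw [innerSL_apply_apply, inner_e_left]
  by_cases h : m = n
  · subst h; simp [e_apply]
  · simp [e_apply, h, Ne.symm h]

lemma sub_H₀_geomVec {w : ℂ} (h0 : w ≠ 0) (h1 : ‖w‖ < 1) :
    (joukowski w • geomVec w - H₀ (geomVec w)) = (w - w⁻¹) • e 0 := by
  refine lp.ext (funext fun n => ?_)
  simp only [lp.coeFn_sub, lp.coeFn_smul, Pi.sub_apply, Pi.smul_apply, H₀_apply,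
    geomVec_apply h1, e_apply, smul_eq_mul, joukowski]
  rcases lt_trichotomy n 0 with h | h | h
  · obtain ⟨k, rfl⟩ : ∃ k : ℕ, n = -((k : ℤ) + 1) := ⟨(-n - 1).toNat, by omega⟩
    have e1 : (-((k : ℤ) + 1)).natAbs = k + 1 := by omega
    have e2 : (-((k : ℤ) + 1) + 1).natAbs = k := by omega
    have e3 : (-((k : ℤ) + 1) - 1).natAbs = k + 2 := by omega
    rw [e1, e2, e3, if_neg (by omega)]
    field_simp
    ring
  · subst h
    simp
  · obtain ⟨k, rfl⟩ : ∃ k : ℕ, n = (k : ℤ) + 1 := ⟨(n - 1).toNat, by omega⟩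
    have e1 : ((k : ℤ) + 1).natAbs = k + 1 := by omega
    have e2 : ((k : ℤ) + 1 + 1).natAbs = k + 2 := by omega
    have e3 : ((k : ℤ) + 1 - 1).natAbs = k := by omega
    rw [e1, e2, e3, if_neg (by omega)]
    field_simp
    ring

lemma shift_neg_e_zero (m : ℤ) : shift (-m) (e 0) = e m := by
  refine lp.ext (funext fun n => ?_)
  simp only [shift_apply, e_apply]
  congr 1
  rw [add_neg_eq_zero]

lemma one_sub_sq_ne_zero {w : ℂ} (h1 : ‖w‖ < 1) : 1 - w ^ 2 ≠ 0 := by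
  intro h
  have h2 : ‖w ^ 2‖ = 1 := by rw [← sub_eq_zero.1 h, norm_one]
  rw [norm_pow] at h2
  nlinarith [norm_nonneg w]

/-- The Green function of `H₀`. -/
lemma entry_resolvent_H₀ {w : ℂ} (h0 : w ≠ 0) (h1 : ‖w‖ < 1) (n m : ℤ) :
    entry (resolvent H₀ (joukowski w)) n m = -(w / (1 - w ^ 2) * w ^ (n - m).natAbs) := by
  have hw := one_sub_sq_ne_zero h1
  have hu := isUnit_sub_H₀ h0 h1
  have hv : (algebraMap ℂ (L2Z →L[ℂ] L2Z) (joukowski w) - H₀)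
      (-(w / (1 - w ^ 2)) • shift (-m) (geomVec w)) = e m := by
    have h := congrArg (shift (-m)) (sub_H₀_geomVec h0 h1)
    rw [map_sub, ← H₀_shift, map_smul, map_smul, shift_neg_e_zero] at h
    rw [Algebra.algebraMap_eq_smul_one, map_smul, sub_apply, smul_apply, one_apply_eq_self, h,
      smul_smul]
    have hc : -(w / (1 - w ^ 2)) * (w - w⁻¹) = 1 := by field_simp; ring
    rw [hc, one_smul]
  have hr : resolvent H₀ (joukowski w) (e m) = -(w / (1 - w ^ 2)) • shift (-m) (geomVec w) := by
    rw [← hv, resolvent, ← mul_apply_eq_comp, Ring.inverse_mul_cancel _ hu, one_apply_eq_self]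
  rw [entry_eq_apply, hr, lp.coeFn_smul, Pi.smul_apply, shift_apply, geomVec_apply h1, smul_eq_mul,
    ← sub_eq_add_neg, neg_mul]

/-! ### The interval `[0, 4]` lies in the spectrum -/

/-- The spectrum of `H₀` persists under the perturbation: translating a test vector to infinity
makes the perturbation negligible on it, and the test vectors `geomVec w` approach a generalized
eigenvector of `H₀` as `w` approaches the unit circle. -/
lemma Icc_subset_spectrum_H {q : ℝ} (h0 : 0 ≤ q) (h1 : q < 1) (K : L2Z →L[ℂ] L2Z) {x : ℝ}
    (hx : x ∈ Set.Icc (0 : ℝ) 4) : (x : ℂ) ∈ spectrum ℂ (H (weight q * K * weight q)) := by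
  obtain ⟨w₀, hw₀, hxw⟩ := exists_joukowski_eq_of_mem_Icc hx
  have hw₀0 : w₀ ≠ 0 := by rw [← norm_ne_zero_iff, hw₀]; exact one_ne_zero
  by_contra hns
  rw [spectrum.notMem_iff] at hns
  set R := Ring.inverse (algebraMap ℂ (L2Z →L[ℂ] L2Z) x - H (weight q * K * weight q)) with hR
  have hbelow : ∀ y : L2Z, ‖y‖ ≤ ‖R‖ * ‖(x : ℂ) • y - H₀ y‖ := by
    intro y
    have hk : ∀ k : ℤ, ‖y‖ ≤ ‖R‖ * (‖(x : ℂ) • y - H₀ y‖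
        + ‖(weight q * K) (weight q (shift k y))‖) := by
      intro k
      have e1 : R ((algebraMap ℂ (L2Z →L[ℂ] L2Z) x - H (weight q * K * weight q)) (shift k y))
          = shift k y := by
        rw [← mul_apply_eq_comp, Ring.inverse_mul_cancel _ hns, one_apply_eq_self]
      have e2 : (algebraMap ℂ (L2Z →L[ℂ] L2Z) x - H (weight q * K * weight q)) (shift k y)
          = shift k ((x : ℂ) • y - H₀ y) - (weight q * K) (weight q (shift k y)) := by
        rw [H, Algebra.algebraMap_eq_smul_one, sub_apply, add_apply, smul_apply,
          one_apply_eq_self, H₀_shift, map_sub, map_smul, mul_apply_eq_comp (weight q * K)]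
        abel
      calc ‖y‖ = ‖shift k y‖ := ((shift k).norm_map y).symm
        _ = ‖R (shift k ((x : ℂ) • y - H₀ y) - (weight q * K) (weight q (shift k y)))‖ := by
            rw [← e2, e1]
        _ ≤ ‖R‖ * ‖shift k ((x : ℂ) • y - H₀ y) - (weight q * K) (weight q (shift k y))‖ :=
            R.le_opNorm _
        _ ≤ _ := by
            refine mul_le_mul_of_nonneg_left ((norm_sub_le _ _).trans_eq ?_) (norm_nonneg _)
            rw [(shift k).norm_map]
    have hl := ((((weight q * K).continuous.tendsto 0).comp
      (tendsto_weight_shift h0 h1 y)).norm.const_add ‖(x : ℂ) • y - H₀ y‖).const_mul ‖R‖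
    rw [map_zero, norm_zero, add_zero] at hl
    exact ge_of_tendsto' hl hk
  -- approach the unit circle radially
  have hcont : Tendsto (fun r : ℝ => ‖(x : ℂ) - joukowski (r * w₀)‖) (𝓝[<] 1) (𝓝 0) := by
    have hc : ContinuousAt (fun r : ℝ => ‖(x : ℂ) - joukowski (r * w₀)‖) 1 := by
      unfold joukowski
      have hne : (((1 : ℝ) : ℂ) * w₀) ≠ 0 := by simpa using hw₀0
      fun_prop (disch := exact hne)
    have := hc.tendsto.mono_left (nhdsWithin_le_nhds (s := Set.Iio 1))
    simpa [hxw] using this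
  have hbound : ∀ᶠ r : ℝ in 𝓝[<] 1, ‖geomVec (r * w₀)‖ ≤ 6 * ‖R‖ := by
    have e1 := hcont.const_mul ‖R‖
    rw [mul_zero] at e1
    filter_upwards [e1.eventually_lt_const (show (0 : ℝ) < 1 / 2 by norm_num),
      self_mem_nhdsWithin, nhdsWithin_le_nhds (lt_mem_nhds (show (1 / 2 : ℝ) < 1 by norm_num))]
      with r hr hr1 hr2
    have hr1 : r < 1 := hr1
    have hr2 : 1 / 2 < r := hr2
    have hn : ‖(r : ℂ) * w₀‖ = r := by
      rw [norm_mul, hw₀, mul_one, Complex.norm_real, Real.norm_of_nonneg (by linarith)]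
    have hne : (r : ℂ) * w₀ ≠ 0 := by rw [← norm_ne_zero_iff, hn]; linarith
    have hb := hbelow (geomVec (r * w₀))
    have e2 : (x : ℂ) • geomVec (r * w₀) - H₀ (geomVec (r * w₀))
        = ((x : ℂ) - joukowski (r * w₀)) • geomVec (r * w₀)
          + (r * w₀ - (r * w₀)⁻¹) • e 0 := by
      rw [← sub_H₀_geomVec hne (by rw [hn]; exact hr1)]
      module
    have e3 : ‖(x : ℂ) • geomVec (r * w₀) - H₀ (geomVec (r * w₀))‖
        ≤ ‖(x : ℂ) - joukowski (r * w₀)‖ * ‖geomVec (r * w₀)‖ + 3 := by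
      rw [e2]
      refine (norm_add_le _ _).trans ?_
      rw [norm_smul, norm_smul, norm_e, mul_one]
      refine add_le_add le_rfl ((norm_sub_le _ _).trans ?_)
      rw [norm_inv, hn]
      have : r⁻¹ ≤ 2 := by rw [inv_le_comm₀ (by linarith) two_pos]; linarith
      linarith
    have e4 := mul_le_mul_of_nonneg_left e3 (norm_nonneg R)
    nlinarith [norm_nonneg (geomVec (r * w₀))]
  obtain ⟨N, hN⟩ := exists_nat_gt ((6 * ‖R‖) ^ 2)
  have hsum : ∀ᶠ r : ℝ in 𝓝[<] 1, ∑ n ∈ Finset.range N, r ^ (2 * n) ≤ (6 * ‖R‖) ^ 2 := by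
    filter_upwards [hbound, self_mem_nhdsWithin,
      nhdsWithin_le_nhds (lt_mem_nhds (show (0 : ℝ) < 1 by norm_num))] with r hr hr1 hr2
    have hr1 : r < 1 := hr1
    have hr2 : 0 < r := hr2
    have hn : ‖(r : ℂ) * w₀‖ = r := by
      rw [norm_mul, hw₀, mul_one, Complex.norm_real, Real.norm_of_nonneg hr2.le]
    have hs := lp.sum_rpow_le_norm_rpow (p := 2) (by norm_num) (geomVec (r * w₀))
      ((Finset.range N).map Nat.castEmbedding)
    rw [Finset.sum_map] at hs
    simp only [Nat.castEmbedding_apply, geomVec_apply (hn.trans_lt hr1), Int.natAbs_natCast,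
      norm_pow, hn, ENNReal.toReal_ofNat, Real.rpow_two] at hs
    calc ∑ n ∈ Finset.range N, r ^ (2 * n) = ∑ n ∈ Finset.range N, (r ^ n) ^ 2 := by
          refine Finset.sum_congr rfl fun n _ => ?_
          rw [← pow_mul, mul_comm]
      _ ≤ _ := hs
      _ ≤ _ := by gcongr
  have hlim : Tendsto (fun r : ℝ => ∑ n ∈ Finset.range N, r ^ (2 * n)) (𝓝[<] 1) (𝓝 (N : ℝ)) := by
    have hc : Continuous fun r : ℝ => ∑ n ∈ Finset.range N, r ^ (2 * n) := by fun_prop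
    have := (hc.tendsto 1).mono_left (nhdsWithin_le_nhds (s := Set.Iio 1))
    simpa using this
  exact absurd (le_of_tendsto hlim hsum) (not_le.2 hN)

lemma joukowski_notMem_Icc {w : ℂ} (h0 : w ≠ 0) (h1 : ‖w‖ < 1) {x : ℝ}
    (hx : x ∈ Set.Icc (0 : ℝ) 4) : joukowski w ≠ x := by
  intro h
  have hs := Icc_subset_spectrum_H le_rfl one_pos 0 hx
  rw [mul_zero, zero_mul, H, add_zero, ← h] at hs
  exact hs (isUnit_sub_H₀ h0 h1)

/-! ### Determinants of finite rank perturbations -/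

section Determinant

variable {E : Type*} [NormedAddCommGroup E] [NormedSpace ℂ E]

lemma isUnit_one_add_comp_swap {F : Type*} [NormedAddCommGroup F] [NormedSpace ℂ F]
    (A : F →L[ℂ] E) (B : E →L[ℂ] F) (h : IsUnit (1 + B.comp A)) : IsUnit (1 + A.comp B) := by
  obtain ⟨⟨u, v, huv, hvu⟩, hu⟩ := h
  simp only at hu
  subst hu
  have h1 : ∀ y, v y + B (A (v y)) = y := fun y => by
    simpa using congrArg (fun T : F →L[ℂ] F => T y) huv
  have h2 : ∀ y, v y + v (B (A y)) = y := fun y => by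
    simpa using congrArg (fun T : F →L[ℂ] F => T y) hvu
  refine ⟨⟨1 + A.comp B, 1 - A.comp (v.comp B), ?_, ?_⟩, rfl⟩
  · ext x
    have h := congrArg A (h1 (B x))
    rw [map_add] at h
    simp only [mul_apply_eq_comp, add_apply, sub_apply, one_apply_eq_self,
      ContinuousLinearMap.comp_apply, map_sub]
    rw [← h]
    abel
  · ext x
    have h := congrArg A (h2 (B x))
    rw [map_add] at h
    simp only [mul_apply_eq_comp, add_apply, sub_apply, one_apply_eq_self,
      ContinuousLinearMap.comp_apply, map_add]
    nth_rw 1 [← h]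
    abel

/-- The matrix `diag η + (bᵢ (G⁻¹ aⱼ))ᵢⱼ` which governs the invertibility of the finite rank
perturbation `G + ∑ᵢ ηᵢ⁻¹ aᵢ ⊗ bᵢ`. -/
def feshbachMatrix {ι : Type*} [DecidableEq ι] (G : E →L[ℂ] E) (η : ι → ℂ) (a : ι → E)
    (b : ι → E →L[ℂ] ℂ) : Matrix ι ι ℂ :=
  Matrix.diagonal η + Matrix.of fun i j => b i (Ring.inverse G (a j))

lemma isUnit_add_sum_of_det_ne_zero {ι : Type*} [Fintype ι] [DecidableEq ι]
    {G : E →L[ℂ] E} (hG : IsUnit G) {η : ι → ℂ} (hη : ∀ i, η i ≠ 0) (a : ι → E)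
    (b : ι → E →L[ℂ] ℂ) (hd : (feshbachMatrix G η a b).det ≠ 0) :
    IsUnit (G + ∑ i, (η i)⁻¹ • (b i).smulRight (a i)) := by
  set A : (ι → ℂ) →L[ℂ] E :=
    ∑ i, (ContinuousLinearMap.proj (R := ℂ) (φ := fun _ : ι => ℂ) i).smulRight
      (Ring.inverse G (a i)) with hA
  set B : E →L[ℂ] (ι → ℂ) := ContinuousLinearMap.pi fun i => (η i)⁻¹ • b i with hB
  have hBA : IsUnit (1 + B.comp A) := by
    have hm : IsUnit (Matrix.diagonal η⁻¹ * feshbachMatrix G η a b) := by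
      rw [Matrix.isUnit_iff_isUnit_det, Matrix.det_mul, Matrix.det_diagonal]
      refine (isUnit_iff_ne_zero.2 ?_).mul (isUnit_iff_ne_zero.2 hd)
      exact Finset.prod_ne_zero_iff.2 fun i _ => inv_ne_zero (hη i)
    have hm2 := (hm.map (Matrix.toLinAlgEquiv' (R := ℂ) (n := ι))).map
      (Module.End.toContinuousLinearMap (𝕜 := ℂ) (ι → ℂ))
    convert! hm2 using 1
    ext x i
    change x i + (η i)⁻¹ * b i (A x)
      = (Matrix.diagonal η⁻¹ * feshbachMatrix G η a b).mulVec x i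
    rw [← Matrix.mulVec_mulVec, Matrix.mulVec_diagonal, feshbachMatrix, Matrix.add_mulVec,
      Pi.add_apply, Matrix.mulVec_diagonal, mul_add, Pi.inv_apply, inv_mul_cancel_left₀ (hη i)]
    congr 2
    simp only [hA, sum_apply, map_sum, Matrix.mulVec, dotProduct,
      Matrix.of_apply, ContinuousLinearMap.smulRight_apply, ContinuousLinearMap.proj_apply,
      map_smul, smul_eq_mul]
    exact Finset.sum_congr rfl fun j _ => mul_comm _ _
  convert! hG.mul (isUnit_one_add_comp_swap A B hBA) using 1
  ext x
  have hGi : ∀ y, G (Ring.inverse G y) = y := fun y => by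
    rw [← mul_apply_eq_comp, Ring.mul_inverse_cancel _ hG, one_apply_eq_self]
  simp only [hA, hB, mul_apply_eq_comp, add_apply, one_apply_eq_self, map_add, map_sum,
    ContinuousLinearMap.comp_apply, sum_apply, smul_apply,
    ContinuousLinearMap.smulRight_apply, ContinuousLinearMap.proj_apply, map_smul, hGi,
    ContinuousLinearMap.pi_apply, smul_eq_mul, smul_smul]

lemma differentiableOn_det_feshbachMatrix [CompleteSpace E] {ι : Type*} [Fintype ι] [DecidableEq ι]
    {U : Set ℂ} {G : ℂ → E →L[ℂ] E} {η : ι → ℂ → ℂ} {a : ι → ℂ → E} {b : ι → ℂ → E →L[ℂ] ℂ}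
    (hG : DifferentiableOn ℂ G U) (hGu : ∀ w ∈ U, IsUnit (G w))
    (hη : ∀ i, DifferentiableOn ℂ (η i) U) (ha : ∀ i, DifferentiableOn ℂ (a i) U)
    (hb : ∀ i, DifferentiableOn ℂ (b i) U) :
    DifferentiableOn ℂ (fun w => (feshbachMatrix (G w) (fun i => η i w) (fun i => a i w)
      (fun i => b i w)).det) U := by
  have hinv : DifferentiableOn ℂ (fun w => Ring.inverse (G w)) U := by
    intro w hw
    obtain ⟨u, hu⟩ := hGu w hw
    have h1 : DifferentiableAt ℂ Ring.inverse (G w) := by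
      rw [← hu]; exact differentiableAt_inverse u.isUnit
    exact h1.comp_differentiableWithinAt w (hG w hw)
  simp only [Matrix.det_apply]
  refine DifferentiableOn.fun_sum fun σ _ => DifferentiableOn.const_smul ?_ _
  refine DifferentiableOn.fun_finsetProd fun i _ => ?_
  simp only [feshbachMatrix, Matrix.add_apply, Matrix.of_apply]
  refine DifferentiableOn.add ?_ ((hb _).clm_apply (hinv.clm_apply (ha _)))
  by_cases h : σ i = i
  · simpa only [Matrix.diagonal_apply, h, if_true] using hη _
  · simpa only [Matrix.diagonal_apply, h, if_false] using differentiableOn_const _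

end Determinant

/-! ### Analytic continuation of the weighted free resolvent -/

/-- The kernel of the weighted free resolvent with a Dirichlet condition at the origin, which is
a polynomial in `w`. -/
def dirichletKernel (s : ℝ) (w : ℂ) (p : ℤ × ℤ) : ℂ :=
  (s ^ 2 : ℝ) ^ (p.1.natAbs + p.2.natAbs) *
    if 0 < p.1 * p.2 then
      w ^ (1 + (p.1 - p.2).natAbs) * ∑ j ∈ Finset.range (min p.1.natAbs p.2.natAbs), w ^ (2 * j)
    else 0

lemma natAbs_sub_add_two_mul_min {n m : ℤ} (h : 0 < n * m) :
    (n - m).natAbs + 2 * min n.natAbs m.natAbs = n.natAbs + m.natAbs := by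
  rcases pos_and_pos_or_neg_and_neg_of_mul_pos h with h | h <;> omega

lemma natAbs_sub_of_mul_nonpos {n m : ℤ} (h : ¬ 0 < n * m) :
    (n - m).natAbs = n.natAbs + m.natAbs := by
  rcases lt_trichotomy n 0 with hn | hn | hn <;> rcases lt_trichotomy m 0 with hm | hm | hm
  any_goals omega
  · exact absurd (mul_pos_of_neg_of_neg hn hm) h
  · exact absurd (mul_pos hn hm) h

lemma dirichletKernel_eq (s : ℝ) {w : ℂ} (hw : 1 - w ^ 2 ≠ 0) (n m : ℤ) :
    dirichletKernel s w (n, m)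
        + w / (1 - w ^ 2) * ((s ^ 2 : ℝ) * w) ^ (n.natAbs + m.natAbs)
      = (s ^ 2 : ℝ) ^ (n.natAbs + m.natAbs) * (w / (1 - w ^ 2) * w ^ (n - m).natAbs) := by
  rw [dirichletKernel, mul_pow]
  simp only
  split_ifs with h
  · rw [← natAbs_sub_add_two_mul_min h]
    have hg := geom_sum_mul (w ^ 2) (min n.natAbs m.natAbs)
    simp only [← pow_mul] at hg
    have hg2 : ∑ j ∈ Finset.range (min n.natAbs m.natAbs), w ^ (2 * j)
        = (1 - w ^ (2 * min n.natAbs m.natAbs)) / (1 - w ^ 2) := by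
      rw [eq_div_iff hw]; linear_combination -hg
    rw [hg2]
    field_simp
    ring
  · rw [natAbs_sub_of_mul_nonpos h]
    ring

lemma norm_dirichletKernel_le {s : ℝ} (hs0 : 0 < s) (hs1 : s < 1) {w : ℂ}
    (hw : w ∈ Metric.ball (0 : ℂ) s⁻¹) (p : ℤ × ℤ) :
    ‖dirichletKernel s w p‖ ≤ p.1.natAbs * s ^ (p.1.natAbs + p.2.natAbs) := by
  have hw1 : ‖w‖ ≤ s⁻¹ := (mem_ball_zero_iff.1 hw).le
  have hs2 : 1 ≤ s⁻¹ := (one_le_inv₀ hs0).2 hs1.le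
  obtain ⟨n, m⟩ := p
  rw [dirichletKernel, norm_mul, norm_pow, Complex.norm_real, Real.norm_of_nonneg (by positivity)]
  simp only
  split_ifs with h
  · have hmin := natAbs_sub_add_two_mul_min h
    have hb : ‖w ^ (1 + (n - m).natAbs) *
        ∑ j ∈ Finset.range (min n.natAbs m.natAbs), w ^ (2 * j)‖
        ≤ n.natAbs * s⁻¹ ^ (n.natAbs + m.natAbs) := by
      rw [Finset.mul_sum]
      refine (norm_sum_le_of_le _ (f := fun j => w ^ (1 + (n - m).natAbs) * w ^ (2 * j))
        (n := fun _ => s⁻¹ ^ (n.natAbs + m.natAbs)) fun j hj => ?_).trans ?_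
      · have hj := Finset.mem_range.1 hj
        rw [← pow_add, norm_pow]
        exact (pow_le_pow_left₀ (norm_nonneg _) hw1 _).trans
          (pow_le_pow_right₀ hs2 (by omega))
      · rw [Finset.sum_const, Finset.card_range, nsmul_eq_mul]
        have : ((min n.natAbs m.natAbs : ℕ) : ℝ) ≤ n.natAbs := by
          exact_mod_cast min_le_left _ _
        gcongr
    refine (mul_le_mul_of_nonneg_left hb (by positivity)).trans_eq ?_
    rw [← pow_mul, mul_comm 2, pow_mul, sq, inv_pow]
    field_simp
  · rw [norm_zero, mul_zero]; positivity

lemma summable_dirichletKernel {s : ℝ} (hs0 : 0 < s) (hs1 : s < 1) {w : ℂ}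
    (hw : w ∈ Metric.ball (0 : ℂ) s⁻¹) : Summable fun p => ‖dirichletKernel s w p‖ :=
  Summable.of_nonneg_of_le (fun _ => norm_nonneg _) (norm_dirichletKernel_le hs0 hs1 hw)
    (summable_natAbs_geom_prod hs0.le hs1)

lemma differentiableOn_dirichlet {s : ℝ} (hs0 : 0 < s) (hs1 : s < 1) :
    DifferentiableOn ℂ (fun w => kernelOp (dirichletKernel s w)) (Metric.ball 0 s⁻¹) := by
  refine differentiableOn_kernelOp Metric.isOpen_ball (summable_natAbs_geom_prod hs0.le hs1)
    (fun p => ?_) fun p w hw => norm_dirichletKernel_le hs0 hs1 hw p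
  unfold dirichletKernel
  split_ifs <;> fun_prop

lemma kernelOp_dirichletKernel_zero (s : ℝ) : kernelOp (dirichletKernel s 0) = 0 := by
  have h : dirichletKernel s 0 = 0 := by
    funext p
    simp [dirichletKernel, pow_add]
  simp [kernelOp, h]

/-- The linear functional with coefficients `n ↦ w ^ |n|`, for `|w| < 1`. -/
def geomFunctional (w : ℂ) : L2Z →L[ℂ] ℂ := ∑' n : ℤ, w ^ n.natAbs • innerSL ℂ (e n)

lemma geomFunctional_e {w : ℂ} (h1 : ‖w‖ < 1) (m : ℤ) : geomFunctional w (e m) = w ^ m.natAbs := by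
  have hs : HasSum (fun n : ℤ => w ^ n.natAbs • innerSL ℂ (e n)) (geomFunctional w) := by
    refine Summable.hasSum (Summable.of_norm ?_)
    simpa only [norm_smul, innerSL_apply_norm, norm_e, mul_one, norm_pow] using
      summable_geom_natAbs (norm_nonneg w) h1
  refine (hs.mapL (ContinuousLinearMap.apply ℂ ℂ (e m))).unique ?_
  convert! hasSum_ite_eq m (w ^ m.natAbs) using 1
  funext n
  simp only [ContinuousLinearMap.apply_apply, smul_apply, innerSL_apply_apply, inner_e_left,
    e_apply]
  by_cases h : n = m
  · subst h; simp
  · simp [h]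

lemma differentiableOn_geom_tsum {F : Type*} [NormedAddCommGroup F] [NormedSpace ℂ F]
    [CompleteSpace F] {v : ℤ → F} (hv : ∀ n, ‖v n‖ = 1) {s : ℝ} (hs0 : 0 < s) (hs1 : s < 1) :
    DifferentiableOn ℂ (fun w : ℂ => ∑' n : ℤ, (((s ^ 2 : ℝ) : ℂ) * w) ^ n.natAbs • v n)
      (Metric.ball 0 s⁻¹) := by
  refine Complex.differentiableOn_tsum_of_summable_norm (summable_geom_natAbs hs0.le hs1)
    (fun n => by fun_prop) Metric.isOpen_ball fun n w hw => ?_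
  rw [norm_smul, hv, mul_one, norm_pow]
  refine pow_le_pow_left₀ (norm_nonneg _) ?_ _
  rw [norm_mul, Complex.norm_real, Real.norm_of_nonneg (by positivity)]
  calc s ^ 2 * ‖w‖ ≤ s ^ 2 * s⁻¹ :=
        mul_le_mul_of_nonneg_left (mem_ball_zero_iff.1 hw).le (by positivity)
    _ = s := by field_simp

lemma norm_sq_mul_lt_one {s : ℝ} (hs0 : 0 < s) (hs1 : s < 1) {w : ℂ}
    (hw : w ∈ Metric.ball (0 : ℂ) s⁻¹) : ‖((s ^ 2 : ℝ) : ℂ) * w‖ < 1 := by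
  rw [norm_mul, Complex.norm_real, Real.norm_of_nonneg (by positivity)]
  calc s ^ 2 * ‖w‖ ≤ s ^ 2 * s⁻¹ :=
        mul_le_mul_of_nonneg_left (mem_ball_zero_iff.1 hw).le (by positivity)
    _ = s := by field_simp
    _ < 1 := hs1

/-- The continuation of `w ↦ W (H₀ - z)⁻¹ W`, `z = joukowski w`, to `|w| < s⁻¹`: the sum of an
analytic family and of a rank one term with a pole at the points `±1` which correspond to the
thresholds. -/
def weightedResolvent (s : ℝ) (w : ℂ) : L2Z →L[ℂ] L2Z :=
  kernelOp (dirichletKernel s w)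
    + (w / (1 - w ^ 2)) • (geomFunctional ((s ^ 2 : ℝ) * w)).smulRight (geomVec ((s ^ 2 : ℝ) * w))

lemma weightedResolvent_eq {s : ℝ} (hs0 : 0 < s) (hs1 : s < 1) {w : ℂ} (h0 : w ≠ 0)
    (h1 : ‖w‖ < 1) : weightedResolvent s w
      = -(weight (s ^ 2) * resolvent H₀ (joukowski w) * weight (s ^ 2)) := by
  have hwb : w ∈ Metric.ball (0 : ℂ) s⁻¹ :=
    mem_ball_zero_iff.2 (h1.trans ((one_lt_inv₀ hs0).2 hs1))
  have hsw := norm_sq_mul_lt_one hs0 hs1 hwb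
  refine ext_entry fun n m => ?_
  have e1 := entry_weight_mul_mul (q := s ^ 2) (by positivity) (pow_lt_one₀ hs0.le hs1 two_ne_zero)
    (resolvent H₀ (joukowski w)) n m
  rw [entry_resolvent_H₀ h0 h1] at e1
  have e2 := entry_kernelOp (summable_dirichletKernel hs0 hs1 hwb) n m
  have e3 := dirichletKernel_eq s (one_sub_sq_ne_zero h1) n m
  rw [entry_eq_apply] at e1 e2
  rw [entry_eq_apply, entry_eq_apply, neg_apply, lp.coeFn_neg, Pi.neg_apply, e1,
    weightedResolvent, add_apply, lp.coeFn_add, Pi.add_apply, e2, smul_apply,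
    ContinuousLinearMap.smulRight_apply, geomFunctional_e hsw, lp.coeFn_smul, lp.coeFn_smul,
    Pi.smul_apply, Pi.smul_apply, geomVec_apply hsw, smul_eq_mul, smul_eq_mul, mul_neg, neg_neg,
    ← e3]
  ring

lemma differentiableOn_weightedResolvent {s : ℝ} (hs0 : 0 < s) (hs1 : s < 1) :
    DifferentiableOn ℂ (weightedResolvent s) (Metric.ball 0 s⁻¹ ∩ {w | 1 - w ^ 2 ≠ 0}) := by
  have hφ : DifferentiableOn ℂ (fun w : ℂ => geomVec ((s ^ 2 : ℝ) * w)) (Metric.ball 0 s⁻¹) :=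
    differentiableOn_geom_tsum norm_e hs0 hs1
  have hβ : DifferentiableOn ℂ (fun w : ℂ => geomFunctional ((s ^ 2 : ℝ) * w))
      (Metric.ball 0 s⁻¹) :=
    differentiableOn_geom_tsum (v := fun n => innerSL ℂ (e n))
      (fun n => by rw [innerSL_apply_norm, norm_e]) hs0 hs1
  have hb : IsBoundedBilinearMap ℂ fun p : (L2Z →L[ℂ] ℂ) × L2Z => p.1.smulRight p.2 :=
    isBoundedBilinearMap_smulRight
  refine ((differentiableOn_dirichlet hs0 hs1).mono Set.inter_subset_left).add
    (DifferentiableOn.fun_smul ?_ ?_)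
  · intro w hw
    have hw2 : 1 - w ^ 2 ≠ 0 := hw.2
    exact DifferentiableAt.differentiableWithinAt (by fun_prop (disch := exact hw2))
  · exact ((hb.differentiable.comp_differentiableOn (hβ.prodMk hφ))).mono Set.inter_subset_left

/-! ### The Fredholm determinant -/

/-- The Fredholm determinant: a holomorphic function, not identically zero, whose zeros contain all
points `w ≠ ±1` at which `1 + K T(w)` is not invertible. -/
theorem exists_determinant {s : ℝ} (hs0 : 0 < s) (hs1 : s < 1) {k : ℤ × ℤ → ℂ}
    (hk : Summable fun p => ‖k p‖) :
    ∃ d : ℂ → ℂ, DifferentiableOn ℂ d (Metric.ball 0 s⁻¹) ∧ d 0 ≠ 0 ∧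
      ∀ w ∈ Metric.ball (0 : ℂ) s⁻¹, 1 - w ^ 2 ≠ 0 → d w ≠ 0 →
        IsUnit (1 + kernelOp k * weightedResolvent s w) := by
  set B : ℝ := ∑' p : ℤ × ℤ, (p.1.natAbs : ℝ) * s ^ (p.1.natAbs + p.2.natAbs) with hB
  have hB0 : 0 ≤ B := tsum_nonneg fun p => by positivity
  have hBn : ∀ w ∈ Metric.ball (0 : ℂ) s⁻¹, ‖kernelOp (dirichletKernel s w)‖ ≤ B := fun w hw =>
    (norm_kernelOp_le (summable_dirichletKernel hs0 hs1 hw)).trans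
      ((summable_dirichletKernel hs0 hs1 hw).tsum_le_tsum (norm_dirichletKernel_le hs0 hs1 hw)
        (summable_natAbs_geom_prod hs0.le hs1))
  -- a finite truncation of the kernel leaves a remainder that a Neumann series absorbs
  obtain ⟨F, hF⟩ : ∃ F : Finset (ℤ × ℤ),
      ‖kernelOp k - ∑ p ∈ F, k p • rankOne ℂ (e p.1) (e p.2)‖ * (B + 1) < 1 := by
    have h := ((hasSum_kernelOp hk).const_sub (kernelOp k)).norm.mul_const (B + 1)
    rw [sub_self, norm_zero, zero_mul] at h
    exact (h.eventually_lt_const one_pos).exists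
  set KF := ∑ p ∈ F, k p • rankOne ℂ (e p.1) (e p.2) with hKF
  let G : ℂ → L2Z →L[ℂ] L2Z := fun w => 1 + (kernelOp k - KF) * kernelOp (dirichletKernel s w)
  -- the index `none` carries the rank one term, its row being multiplied by `1 - w ^ 2` to clear
  -- the pole; the other indices carry the truncated kernel
  let η : Option F → ℂ → ℂ := fun i w => i.elim (1 - w ^ 2) fun _ => 1
  let a : Option F → ℂ → L2Z := fun i w =>
    i.elim (kernelOp k (geomVec ((s ^ 2 : ℝ) * w))) fun p => k p.1 • e p.1.1
  let b : Option F → ℂ → L2Z →L[ℂ] ℂ := fun i w =>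
    i.elim (w • geomFunctional ((s ^ 2 : ℝ) * w)) fun p =>
      (innerSL ℂ (e p.1.2)).comp (kernelOp (dirichletKernel s w))
  have hG : DifferentiableOn ℂ G (Metric.ball 0 s⁻¹) :=
    ((differentiableOn_const _).mul (differentiableOn_dirichlet hs0 hs1)).const_add _
  have hGu : ∀ w ∈ Metric.ball (0 : ℂ) s⁻¹, IsUnit (G w) := by
    intro w hw
    have h : G w = 1 - -((kernelOp k - KF) * kernelOp (dirichletKernel s w)) := by
      simp only [G, sub_neg_eq_add]
    rw [h]
    refine isUnit_one_sub_of_norm_lt_one ?_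
    rw [norm_neg]
    refine (norm_mul_le _ _).trans_lt (lt_of_le_of_lt ?_ hF)
    exact mul_le_mul_of_nonneg_left ((hBn w hw).trans (by linarith)) (norm_nonneg _)
  have hη : ∀ i, DifferentiableOn ℂ (η i) (Metric.ball 0 s⁻¹) := by
    rintro (_ | p)
    · change DifferentiableOn ℂ (fun w : ℂ => 1 - w ^ 2) _
      fun_prop
    · exact differentiableOn_const _
  have ha : ∀ i, DifferentiableOn ℂ (a i) (Metric.ball 0 s⁻¹) := by
    rintro (_ | p)
    · exact (kernelOp k).differentiable.comp_differentiableOn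
        (differentiableOn_geom_tsum norm_e hs0 hs1)
    · exact differentiableOn_const _
  have hb : ∀ i, DifferentiableOn ℂ (b i) (Metric.ball 0 s⁻¹) := by
    rintro (_ | p)
    · exact differentiableOn_id.smul (differentiableOn_geom_tsum (v := fun n => innerSL ℂ (e n))
        (fun n => by rw [innerSL_apply_norm, norm_e]) hs0 hs1)
    · exact (differentiableOn_const _).clm_comp (differentiableOn_dirichlet hs0 hs1)
  refine ⟨_, differentiableOn_det_feshbachMatrix hG hGu hη ha hb, ?_, ?_⟩
  · have h : feshbachMatrix (G 0) (fun i => η i 0) (fun i => a i 0) (fun i => b i 0) = 1 := by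
      have hb0 : ∀ i, b i 0 = 0 := by
        rintro (_ | p)
        · exact zero_smul ℂ (geomFunctional (((s ^ 2 : ℝ) : ℂ) * 0))
        · change (innerSL ℂ (e p.1.2)).comp (kernelOp (dirichletKernel s 0)) = 0
          rw [kernelOp_dirichletKernel_zero, ContinuousLinearMap.comp_zero]
      have hη0 : ∀ i, η i 0 = 1 := by
        rintro (_ | p) <;> simp [η]
      ext i j
      simp [feshbachMatrix, hb0, hη0, Matrix.one_apply]
    rw [h, Matrix.det_one]
    exact one_ne_zero
  · intro w hw hw2 hd
    have hu := isUnit_add_sum_of_det_ne_zero (hGu w hw) (η := fun i => η i w) (by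
      rintro (_ | p)
      · exact hw2
      · exact one_ne_zero) _ _ hd
    convert! hu using 1
    rw [Fintype.sum_option]
    have hsum : ∑ p : F, (η (some p) w)⁻¹ • (b (some p) w).smulRight (a (some p) w)
        = KF * kernelOp (dirichletKernel s w) := by
      rw [hKF, Finset.sum_mul, ← Finset.sum_coe_sort F]
      refine Finset.sum_congr rfl fun p _ => ?_
      ext1 x
      simp [η, a, b, smul_smul, mul_comm]
    rw [hsum]
    ext1 x
    simp only [G, η, a, b, Option.elim, weightedResolvent, add_apply, sub_apply,
      mul_apply_eq_comp, one_apply_eq_self, map_add, map_smul, smul_apply,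
      ContinuousLinearMap.smulRight_apply, smul_smul, smul_eq_mul]
    rw [show (1 - w ^ 2)⁻¹ * (w * geomFunctional (((s ^ 2 : ℝ) : ℂ) * w) x)
      = w / (1 - w ^ 2) * geomFunctional (((s ^ 2 : ℝ) : ℂ) * w) x by ring]
    abel

/-! ### The free resolvent on the Fourier side -/

lemma notMem_spectrum_H₀ {z : ℂ} (hz : z.im ≠ 0) : z ∉ spectrum ℂ H₀ := by
  obtain ⟨w, h0, h1, rfl⟩ := exists_joukowski_eq z
  rw [spectrum.notMem_iff]
  refine isUnit_sub_H₀ h0 (lt_of_le_of_ne h1 fun h => hz ?_)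
  rw [joukowski_eq_of_norm_eq_one h, Complex.ofReal_im]

lemma isUnit_sub_H₀_of_im_ne_zero {z : ℂ} (hz : z.im ≠ 0) :
    IsUnit (algebraMap ℂ (L2Z →L[ℂ] L2Z) z - H₀) :=
  spectrum.notMem_iff.1 (notMem_spectrum_H₀ hz)

lemma contDiff_fourier (n : ℤ) :
    ContDiff ℝ ∞ (fun t : ℝ => fourier (T := 2 * Real.pi) n (t : Torus)) := by
  simp only [fourier_coe_apply]
  have hr : ContDiff ℝ ∞ (fun t : ℝ => (t : ℂ)) := Complex.ofRealCLM.contDiff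
  exact ((contDiff_const.mul hr).div_const _).cexp

/-- The exponential `exp(inϑ)` as a smooth function on the torus. -/
def smoothFourier (n : ℤ) : smoothTorus := ⟨fourier n, contDiff_fourier n⟩

lemma fourier_torus_apply (n : ℤ) (t : ℝ) :
    fourier (T := 2 * Real.pi) n (t : Torus) = Complex.exp (n * t * Complex.I) := by
  rw [fourier_coe_apply]
  congr 1
  have : (Real.pi : ℂ) ≠ 0 := by exact_mod_cast Real.pi_ne_zero
  push_cast
  field_simp

/-- The product of two smooth functions on the torus. -/
def smoothMul (k f : smoothTorus) : smoothTorus :=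
  ⟨k.1 * f.1, (smoothTorus_contDiff k).mul (smoothTorus_contDiff f)⟩

/-- The symbol `2 - 2 cos ϑ` of `H₀`. -/
def symbolFun : C(Torus, ℂ) := 2 - fourier 1 - fourier (-1)

lemma symbolFun_apply (t : ℝ) : symbolFun (t : Torus) = ((2 - 2 * Real.cos t : ℝ) : ℂ) := by
  change (2 : ℂ) - fourier (T := 2 * Real.pi) 1 (t : Torus) - fourier (-1) (t : Torus) = _
  rw [fourier_torus_apply, fourier_torus_apply]
  push_cast
  rw [Complex.cos]
  ring_nf

lemma symbolFun_im (x : Torus) : (symbolFun x).im = 0 := by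
  induction x using QuotientAddGroup.induction_on with
  | H t => exact (congrArg Complex.im (symbolFun_apply t)).trans (Complex.ofReal_im _)

lemma contDiff_symbolFun : ContDiff ℝ ∞ (fun t : ℝ => symbolFun (t : Torus)) :=
  (contDiff_const.sub (contDiff_fourier 1)).sub (contDiff_fourier (-1))

/-- The symbol `2 - 2 cos ϑ` as a smooth function. -/
def symbol : smoothTorus := ⟨symbolFun, contDiff_symbolFun⟩

lemma sub_symbolFun_ne_zero {z : ℂ} (hz : z.im ≠ 0) (x : Torus) : z - symbolFun x ≠ 0 := by
  intro h
  have h2 := congrArg Complex.im h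
  rw [Complex.sub_im, symbolFun_im, sub_zero] at h2
  exact hz h2

/-- The function `(z - (2 - 2 cos ϑ))⁻¹`, for nonreal `z`. -/
def resolventSymbol {z : ℂ} (hz : z.im ≠ 0) : smoothTorus :=
  ⟨⟨fun x => (z - symbolFun x)⁻¹,
    (continuous_const.sub symbolFun.continuous).inv₀ (sub_symbolFun_ne_zero hz)⟩,
    (contDiff_const.sub contDiff_symbolFun).inv fun t => sub_symbolFun_ne_zero hz t⟩

lemma fourierTransform_symm_apply (v : L2T) (n : ℤ) :
    (fourierTransform.symm v : ℤ → ℂ) n = inner ℂ (fourierLp (T := 2 * Real.pi) 2 (-n)) v := by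
  change (expBasis.repr v : ℤ → ℂ) n = _
  rw [HilbertBasis.repr_apply_apply, expBasis, HilbertBasis.coe_mk]

lemma fourierTransform_e (n : ℤ) : fourierTransform (e n) = smoothToL2 (smoothFourier (-n)) := by
  change expBasis.repr.symm (lp.single 2 n (1 : ℂ)) = _
  rw [HilbertBasis.repr_symm_single, expBasis, HilbertBasis.coe_mk]
  rfl

lemma inner_fourierLp_smoothToL2 (n : ℤ) (f : smoothTorus) :
    inner ℂ (fourierLp (T := 2 * Real.pi) 2 (-n)) (smoothToL2 f)
      = ∫ x, fourier n x * f.1 x ∂(AddCircle.haarAddCircle (T := 2 * Real.pi)) := by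
  change inner ℂ (ContinuousMap.toLp 2 _ ℂ (fourier (-n))) (ContinuousMap.toLp 2 _ ℂ f.1) = _
  rw [MeasureTheory.ContinuousMap.inner_toLp]
  refine MeasureTheory.integral_congr_ae (Eventually.of_forall fun x => ?_)
  simp only
  rw [← fourier_neg, neg_neg, mul_comm]

/-- The Fourier transform turns `H₀` into the multiplication by its symbol. -/
lemma H₀_fourierTransform_symm (f : smoothTorus) :
    H₀ (fourierTransform.symm (smoothToL2 f))
      = fourierTransform.symm (smoothToL2 (smoothMul symbol f)) := by
  refine lp.ext (funext fun n => ?_)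
  rw [H₀_apply]
  simp only [fourierTransform_symm_apply, inner_fourierLp_smoothToL2]
  have hi : ∀ m : ℤ, MeasureTheory.Integrable (fun x => fourier m x * f.1 x)
      (AddCircle.haarAddCircle (T := 2 * Real.pi)) := by
    intro m
    have hc : Continuous fun x => fourier m x * f.1 x := by fun_prop
    exact hc.integrable_of_hasCompactSupport (HasCompactSupport.of_compactSpace _)
  have hi2 : MeasureTheory.Integrable (fun x => 2 * (fourier n x * f.1 x)
      - fourier (n + 1) x * f.1 x) (AddCircle.haarAddCircle (T := 2 * Real.pi)) :=
    ((hi n).const_mul 2).sub (hi _)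
  rw [← MeasureTheory.integral_const_mul, ← MeasureTheory.integral_sub ((hi n).const_mul 2) (hi _),
    ← MeasureTheory.integral_sub hi2 (hi _)]
  refine MeasureTheory.integral_congr_ae (Eventually.of_forall fun x => ?_)
  change 2 * (fourier n x * f.1 x) - fourier (n + 1) x * f.1 x - fourier (n - 1) x * f.1 x
    = fourier n x * ((2 - fourier 1 x - fourier (-1) x) * f.1 x)
  rw [sub_eq_add_neg n 1, fourier_add, fourier_add]
  ring

lemma resolvent_fourierTransform_symm {z : ℂ} (hz : z.im ≠ 0) (f : smoothTorus) :
    resolvent H₀ z (fourierTransform.symm (smoothToL2 f))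
      = fourierTransform.symm (smoothToL2 (smoothMul (resolventSymbol hz) f)) := by
  set u := fourierTransform.symm (smoothToL2 (smoothMul (resolventSymbol hz) f)) with hu
  have h : (algebraMap ℂ (L2Z →L[ℂ] L2Z) z - H₀) u = fourierTransform.symm (smoothToL2 f) := by
    rw [Algebra.algebraMap_eq_smul_one, sub_apply, smul_apply, one_apply_eq_self, hu,
      H₀_fourierTransform_symm, ← map_smul, ← map_sub, ← map_smul, ← map_sub]
    congr 2
    apply Subtype.ext
    ext x
    change z * ((z - symbolFun x)⁻¹ * f.1 x) - symbolFun x * ((z - symbolFun x)⁻¹ * f.1 x) = f.1 x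
    have := sub_symbolFun_ne_zero hz x
    field_simp
  rw [← h, resolvent, ← mul_apply_eq_comp,
    Ring.inverse_mul_cancel _ (isUnit_sub_H₀_of_im_ne_zero hz), one_apply_eq_self]

/-! ### The commutator with the conjugate operator -/

lemma hasDerivAt_smooth (f : smoothTorus) (t : ℝ) :
    HasDerivAt (fun s : ℝ => f.1 (s : Torus)) ((derivTorus f).1 (t : Torus)) t :=
  (smoothTorus_differentiable f t).hasDerivAt

lemma dilation_apply (f : smoothTorus) (t : ℝ) : (dilation f).1 (t : Torus)
    = -Complex.I * (2 * Real.sin t * (derivTorus f).1 (t : Torus)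
      + Real.cos t * f.1 (t : Torus)) := by
  have hsin : HasDerivAt (fun s : ℝ => (Real.sin s : ℂ)) (Real.cos t : ℂ) t :=
    (Real.hasDerivAt_sin t).ofReal_comp
  have h2 : (derivTorus (mulSin f)).1 (t : Torus) = (Real.cos t : ℂ) * f.1 (t : Torus)
      + (Real.sin t : ℂ) * (derivTorus f).1 (t : Torus) :=
    (hsin.mul (hasDerivAt_smooth f t)).deriv
  change (Real.sin t : ℂ) * (-Complex.I * (derivTorus f).1 (t : Torus))
    + -Complex.I * (derivTorus (mulSin f)).1 (t : Torus) = _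
  rw [h2]
  ring

/-- The commutator of the conjugate operator with the resolvent of `H₀`, on smooth functions. It is
again a function of `H₀`, because `(2 sin ϑ)² = λ (4 - λ)` for `λ = 2 - 2 cos ϑ`. -/
lemma dilation_smoothMul_resolventSymbol {z : ℂ} (hz : z.im ≠ 0) (f : smoothTorus) :
    dilation (smoothMul (resolventSymbol hz) f)
      = smoothMul (resolventSymbol hz) (dilation f)
        - Complex.I • ((z * (4 - z)) •
            smoothMul (resolventSymbol hz) (smoothMul (resolventSymbol hz) f)
          - (4 - 2 * z) • smoothMul (resolventSymbol hz) f - f) := by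
  apply Subtype.ext
  ext x
  induction x using QuotientAddGroup.induction_on with
  | H t =>
    have hne := sub_symbolFun_ne_zero hz (t : Torus)
    have hk : HasDerivAt (fun s : ℝ => (z - symbolFun (s : Torus))⁻¹)
        (2 * Real.sin t * (z - symbolFun (t : Torus))⁻¹ ^ 2) t := by
      have h1 : HasDerivAt (fun s : ℝ => z - symbolFun (s : Torus)) (-(2 * Real.sin t : ℂ)) t := by
        simp only [symbolFun_apply]
        have := (((Real.hasDerivAt_cos t).const_mul 2).const_sub 2).ofReal_comp.const_sub z
        convert! this using 1
        push_cast
        ring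
      convert! h1.inv hne using 1
      rw [neg_neg, inv_pow, div_eq_mul_inv]
    have hd : (derivTorus (smoothMul (resolventSymbol hz) f)).1 (t : Torus)
        = 2 * Real.sin t * (z - symbolFun (t : Torus))⁻¹ ^ 2 * f.1 (t : Torus)
          + (z - symbolFun (t : Torus))⁻¹ * (derivTorus f).1 (t : Torus) :=
      (hk.mul (hasDerivAt_smooth f t)).deriv
    change (dilation (smoothMul (resolventSymbol hz) f)).1 (t : Torus)
      = (z - symbolFun (t : Torus))⁻¹ * (dilation f).1 (t : Torus)
        - Complex.I * ((z * (4 - z)) *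
            ((z - symbolFun (t : Torus))⁻¹ * ((z - symbolFun (t : Torus))⁻¹ * f.1 (t : Torus)))
          - (4 - 2 * z) * ((z - symbolFun (t : Torus))⁻¹ * f.1 (t : Torus)) - f.1 (t : Torus))
    rw [dilation_apply, dilation_apply, hd]
    change -Complex.I * (_ + Real.cos t * ((z - symbolFun (t : Torus))⁻¹ * f.1 (t : Torus))) = _
    have hsc : (Real.sin t : ℂ) ^ 2 = 1 - (Real.cos t : ℂ) ^ 2 := by
      rw [eq_sub_iff_add_eq]; exact_mod_cast Real.sin_sq_add_cos_sq t
    have hc : symbolFun (t : Torus) = 2 - 2 * (Real.cos t : ℂ) := by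
      rw [symbolFun_apply]; push_cast; ring
    rw [hc] at hne ⊢
    have hk1 := inv_mul_cancel₀ hne
    generalize (z - (2 - 2 * (Real.cos t : ℂ)))⁻¹ = k at *
    linear_combination (-4 * Complex.I * f.1 (t : Torus) * k ^ 2) * hsc
      - Complex.I * f.1 (t : Torus) * (k * (z - 2 - 2 * Real.cos t) - 1) * hk1

lemma mem_graph_A₀ (x y : L2Z) :
    (x, y) ∈ A₀.graph ↔ (fourierTransform x, fourierTransform y) ∈ Ahat.graph := by
  rw [LinearPMap.mem_graph_iff, LinearPMap.mem_graph_iff]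
  constructor
  · rintro ⟨⟨u, hu⟩, h1, h2⟩
    simp only at h1 h2
    subst h1
    refine ⟨⟨fourierTransform u, hu⟩, rfl, ?_⟩
    rw [← h2]
    change _ = fourierTransform (fourierTransform.symm (Ahat ⟨fourierTransform u, hu⟩))
    rw [LinearIsometryEquiv.apply_symm_apply]
  · rintro ⟨⟨u, hu⟩, h1, h2⟩
    simp only at h1 h2
    subst h1
    refine ⟨⟨x, hu⟩, rfl, ?_⟩
    change fourierTransform.symm (Ahat ⟨fourierTransform x, hu⟩) = y
    rw [h2, LinearIsometryEquiv.symm_apply_apply]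

lemma mem_graph_AhatMin (u v : L2T) :
    (u, v) ∈ AhatMin.graph ↔ ∃ f : smoothTorus, u = smoothToL2 f ∧ v = smoothToL2 (dilation f) := by
  rw [LinearPMap.mem_graph_iff]
  constructor
  · rintro ⟨⟨_, f, rfl⟩, h1, h2⟩
    refine ⟨f, h1.symm, ?_⟩
    rw [← AhatMin_apply f ⟨f, rfl⟩]
    exact h2.symm
  · rintro ⟨f, rfl, rfl⟩
    exact ⟨⟨smoothToL2 f, f, rfl⟩, rfl, AhatMin_apply f _⟩

/-- The graph of the conjugate operator on smooth functions, transported to `ℓ²(ℤ)`. -/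
def smoothGraph : Set (L2Z × L2Z) :=
  Set.range fun f : smoothTorus =>
    (fourierTransform.symm (smoothToL2 f), fourierTransform.symm (smoothToL2 (dilation f)))

lemma smoothGraph_subset : smoothGraph ⊆ (A₀.graph : Set (L2Z × L2Z)) := by
  rintro _ ⟨f, rfl⟩
  rw [SetLike.mem_coe, mem_graph_A₀]
  refine LinearPMap.le_graph_of_le (LinearPMap.le_closure AhatMin) ?_
  rw [mem_graph_AhatMin]
  exact ⟨f, by simp, by simp⟩

lemma graph_A₀_subset_closure : (A₀.graph : Set (L2Z × L2Z)) ⊆ closure smoothGraph := by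
  rintro ⟨x, y⟩ h
  rw [SetLike.mem_coe, mem_graph_A₀, Ahat, ← AhatMin_isClosable.graph_closure_eq_closure_graph,
    ← SetLike.mem_coe, Submodule.topologicalClosure_coe] at h
  have hc : Continuous fun p : L2T × L2T =>
      (fourierTransform.symm p.1, fourierTransform.symm p.2) :=
    (fourierTransform.symm.continuous.comp continuous_fst).prodMk
      (fourierTransform.symm.continuous.comp continuous_snd)
  have h2 := image_closure_subset_closure_image hc ⟨_, h, rfl⟩
  simp only [LinearIsometryEquiv.symm_apply_apply] at h2
  refine closure_mono ?_ h2
  rintro _ ⟨⟨u, v⟩, huv, rfl⟩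
  obtain ⟨f, rfl, rfl⟩ := (mem_graph_AhatMin u v).1 huv
  exact ⟨f, rfl⟩

/-- The commutator of `A₀` with the free resolvent, in the sense of forms on the domain of `A₀`:
`[A₀, (z - H₀)⁻¹] = -i (H₀ (4 - H₀)) (z - H₀)⁻²`. -/
theorem commutator_resolvent {z : ℂ} (hz : z.im ≠ 0) {x x' y y' : L2Z}
    (hx : (x, x') ∈ A₀.graph) (hy : (y, y') ∈ A₀.graph) :
    inner ℂ x' (resolvent H₀ z y) - inner ℂ x (resolvent H₀ z y')
      = -Complex.I * (z * (4 - z) * inner ℂ x (resolvent H₀ z (resolvent H₀ z y))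
        - (4 - 2 * z) * inner ℂ x (resolvent H₀ z y) - inner ℂ x y) := by
  set Q := resolvent H₀ z with hQ
  have hcl : IsClosed {p : (L2Z × L2Z) × (L2Z × L2Z) | inner ℂ p.1.2 (Q p.2.1)
      - inner ℂ p.1.1 (Q p.2.2) = -Complex.I * (z * (4 - z) * inner ℂ p.1.1 (Q (Q p.2.1))
        - (4 - 2 * z) * inner ℂ p.1.1 (Q p.2.1) - inner ℂ p.1.1 p.2.1)} :=
    isClosed_eq (by fun_prop) (by fun_prop)
  have hmem : ((x, x'), (y, y')) ∈ closure (smoothGraph ×ˢ smoothGraph) := by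
    rw [closure_prod_eq]
    exact ⟨graph_A₀_subset_closure hx, graph_A₀_subset_closure hy⟩
  refine closure_minimal ?_ hcl hmem
  rintro ⟨_, _⟩ ⟨⟨f, rfl⟩, ⟨g, rfl⟩⟩
  simp only [Set.mem_ofPred_eq]
  have hsym := AhatMin_symmetric ⟨smoothToL2 f, f, rfl⟩
    ⟨smoothToL2 (smoothMul (resolventSymbol hz) g), _, rfl⟩
  have hs : inner ℂ (smoothToL2 (dilation f)) (smoothToL2 (smoothMul (resolventSymbol hz) g))
      = inner ℂ (smoothToL2 f) (smoothToL2 (dilation (smoothMul (resolventSymbol hz) g))) := by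
    rw [← AhatMin_apply f ⟨f, rfl⟩, ← AhatMin_apply _ ⟨_, rfl⟩]
    exact hsym
  rw [hQ]
  simp only [resolvent_fourierTransform_symm hz, LinearIsometryEquiv.inner_map_map]
  rw [hs, dilation_smoothMul_resolventSymbol hz, map_sub, map_smul, map_sub, map_sub, map_smul,
    map_smul, inner_sub_right, inner_smul_right, inner_sub_right, inner_sub_right,
    inner_smul_right, inner_smul_right]
  ring

/-! ### The conjugate operator on the canonical basis -/

lemma dilation_smoothFourier (n : ℤ) : dilation (smoothFourier n)
    = (2 * Complex.I)⁻¹ • ((2 * n + 1 : ℂ) • smoothFourier (n + 1)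
      - (2 * n - 1 : ℂ) • smoothFourier (n - 1)) := by
  apply Subtype.ext
  ext x
  induction x using QuotientAddGroup.induction_on with
  | H t =>
    have hd : (derivTorus (smoothFourier n)).1 (t : Torus)
        = n * Complex.I * Complex.exp (n * t * Complex.I) := by
      rw [derivTorus_apply]
      change deriv (fun s : ℝ => fourier (T := 2 * Real.pi) n (s : Torus)) t = _
      simp only [fourier_torus_apply]
      have h1 : HasDerivAt (fun s : ℝ => (n : ℂ) * s * Complex.I) (n * Complex.I) t := by
        simpa using ((Complex.ofRealCLM.hasDerivAt (x := t)).const_mul (n : ℂ)).mul_const Complex.I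
      rw [h1.cexp.deriv]
      ring
    change (dilation (smoothFourier n)).1 (t : Torus) = (2 * Complex.I)⁻¹ *
      ((2 * n + 1) * fourier (T := 2 * Real.pi) (n + 1) (t : Torus)
        - (2 * n - 1) * fourier (T := 2 * Real.pi) (n - 1) (t : Torus))
    rw [dilation_apply, hd]
    change -Complex.I * (_ + Real.cos t * fourier (T := 2 * Real.pi) n (t : Torus)) = _
    simp only [fourier_torus_apply]
    have e1 : Complex.exp (((n + 1 : ℤ) : ℂ) * t * Complex.I)
        = Complex.exp (n * t * Complex.I) * Complex.exp (t * Complex.I) := by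
      rw [← Complex.exp_add]; push_cast; ring_nf
    have e2 : Complex.exp (((n - 1 : ℤ) : ℂ) * t * Complex.I)
        = Complex.exp (n * t * Complex.I) * Complex.exp (-t * Complex.I) := by
      rw [← Complex.exp_add]; push_cast; ring_nf
    rw [e1, e2, Complex.ofReal_sin, Complex.ofReal_cos, Complex.sin, Complex.cos]
    have hI : Complex.I ^ 2 = -1 := Complex.I_sq
    field_simp
    ring_nf
    simp only [hI, show Complex.I ^ 4 = 1 by rw [show 4 = 2 * 2 by rfl, pow_mul, hI]; ring]
    ring

/-- The action of `A₀` on the canonical basis. -/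
def A₀e (n : ℤ) : L2Z :=
  (2 * Complex.I)⁻¹ • ((1 - 2 * n : ℂ) • e (n - 1) + (1 + 2 * n : ℂ) • e (n + 1))

lemma e_mem_graph (n : ℤ) : (e n, A₀e n) ∈ A₀.graph := by
  refine smoothGraph_subset ⟨smoothFourier (-n), ?_⟩
  simp only
  rw [← fourierTransform_e, LinearIsometryEquiv.symm_apply_apply, dilation_smoothFourier]
  simp only [map_smul, map_sub]
  have h1 : smoothToL2 (smoothFourier (-n + 1)) = fourierTransform (e (n - 1)) := by
    rw [fourierTransform_e]; congr 2; ring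
  have h2 : smoothToL2 (smoothFourier (-n - 1)) = fourierTransform (e (n + 1)) := by
    rw [fourierTransform_e]; congr 2; ring
  rw [h1, h2, LinearIsometryEquiv.symm_apply_apply, LinearIsometryEquiv.symm_apply_apply, A₀e]
  congr 2
  push_cast
  module

/-- The action of `A₀²` on the canonical basis. -/
def A₀A₀e (n : ℤ) : L2Z :=
  (2 * Complex.I)⁻¹ • ((1 - 2 * n : ℂ) • A₀e (n - 1) + (1 + 2 * n : ℂ) • A₀e (n + 1))

lemma A₀e_mem_graph (n : ℤ) : (A₀e n, A₀A₀e n) ∈ A₀.graph :=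
  A₀.graph.smul_mem _ (A₀.graph.add_mem (A₀.graph.smul_mem _ (e_mem_graph (n - 1)))
    (A₀.graph.smul_mem _ (e_mem_graph (n + 1))))

lemma norm_ladder_le (n : ℤ) {u v : L2Z} {M : ℝ} (hu : ‖u‖ ≤ M) (hv : ‖v‖ ≤ M) :
    ‖(2 * Complex.I)⁻¹ • ((1 - 2 * n : ℂ) • u + (1 + 2 * n : ℂ) • v)‖
      ≤ (2 * n.natAbs + 1) * M := by
  have hM : 0 ≤ M := (norm_nonneg u).trans hu
  have hn : ‖(n : ℂ)‖ = n.natAbs := by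
    rw [Complex.norm_intCast, Nat.cast_natAbs, Int.cast_abs]
  have h1 : ‖(1 - 2 * n : ℂ)‖ ≤ 2 * n.natAbs + 1 := by
    refine (norm_sub_le _ _).trans ?_
    rw [norm_one, norm_mul, hn, Complex.norm_two, add_comm]
  have h2 : ‖(1 + 2 * n : ℂ)‖ ≤ 2 * n.natAbs + 1 := by
    refine (norm_add_le _ _).trans ?_
    rw [norm_one, norm_mul, hn, Complex.norm_two, add_comm]
  rw [norm_smul, norm_inv, norm_mul, Complex.norm_two, Complex.norm_I, mul_one]
  have h3 : ‖(1 - 2 * n : ℂ) • u + (1 + 2 * n : ℂ) • v‖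
      ≤ (2 * n.natAbs + 1) * M + (2 * n.natAbs + 1) * M := by
    refine (norm_add_le _ _).trans (add_le_add ?_ ?_) <;> rw [norm_smul] <;> gcongr
  linarith

lemma norm_A₀e_le (n : ℤ) : ‖A₀e n‖ ≤ 2 * n.natAbs + 1 := by
  exact (norm_ladder_le n (norm_e (n - 1)).le (norm_e (n + 1)).le).trans_eq (mul_one _)

lemma norm_A₀A₀e_le (n : ℤ) : ‖A₀A₀e n‖ ≤ (2 * n.natAbs + 1) * (2 * n.natAbs + 3) := by
  refine norm_ladder_le n ((norm_A₀e_le _).trans ?_) ((norm_A₀e_le _).trans ?_)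
  · have : ((n - 1).natAbs : ℝ) ≤ n.natAbs + 1 := by exact_mod_cast (by omega)
    linarith
  · have : ((n + 1).natAbs : ℝ) ≤ n.natAbs + 1 := by exact_mod_cast (by omega)
    linarith

/-! ### Symmetry and the trivial resolvent bound -/

lemma inner_shift_left (k : ℤ) (x y : L2Z) :
    inner ℂ (shift k x) y = inner ℂ x (shift (-k) y) := by
  have h : shift k (shift (-k) y) = y := lp.ext (funext fun n => by simp [shift_apply])
  rw [← (shift k).inner_map_map x, h]

lemma H₀_symmetric (x y : L2Z) : inner ℂ (H₀ x) y = inner ℂ x (H₀ y) := by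
  have h : ∀ u : L2Z, H₀ u = (2 : ℂ) • u - shift 1 u - shift (-1) u := fun _ => rfl
  rw [h, h, inner_sub_left, inner_sub_left, inner_sub_right, inner_sub_right, inner_shift_left,
    inner_shift_left, neg_neg, inner_smul_left, inner_smul_right, Complex.conj_ofNat]
  ring

lemma sub_H₀_resolvent {z : ℂ} (hz : z.im ≠ 0) (y : L2Z) :
    z • resolvent H₀ z y - H₀ (resolvent H₀ z y) = y := by
  have h := congrArg (fun T : L2Z →L[ℂ] L2Z => T y)
    (Ring.mul_inverse_cancel _ (isUnit_sub_H₀_of_im_ne_zero hz))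
  simpa [Algebra.algebraMap_eq_smul_one, resolvent] using h

lemma norm_resolvent_H₀_le {z : ℂ} (hz : z.im ≠ 0) (y : L2Z) :
    ‖resolvent H₀ z y‖ ≤ ‖y‖ / |z.im| := by
  set u := resolvent H₀ z y with hu
  have h := sub_H₀_resolvent hz y
  rw [← hu] at h
  have hreal : (inner ℂ u (H₀ u)).im = 0 := by
    rw [← Complex.conj_eq_iff_im, inner_conj_symm]
    exact H₀_symmetric u u
  have him : (inner ℂ u y).im = z.im * ‖u‖ ^ 2 := by
    rw [← h, inner_sub_right, inner_smul_right, Complex.sub_im, hreal, sub_zero,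
      inner_self_eq_norm_sq_to_K]
    norm_cast
    exact Complex.im_mul_ofReal _ _
  have hle : |z.im| * ‖u‖ ^ 2 ≤ ‖u‖ * ‖y‖ := by
    rw [← abs_of_nonneg (sq_nonneg ‖u‖), ← abs_mul, ← him]
    exact (Complex.abs_im_le_norm _).trans (norm_inner_le_norm u y)
  rw [le_div_iff₀ (abs_pos.2 hz)]
  rcases (norm_nonneg u).eq_or_lt with h0 | h0
  · rw [← h0, zero_mul]; exact norm_nonneg y
  · nlinarith

lemma inner_resolvent_conj {z : ℂ} (hz : z.im ≠ 0) (x y : L2Z) :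
    inner ℂ x (resolvent H₀ z y) = inner ℂ (resolvent H₀ ((starRingEnd ℂ) z) x) y := by
  have hz' : ((starRingEnd ℂ) z).im ≠ 0 := by simpa using hz
  have h1 := sub_H₀_resolvent hz y
  have h2 := sub_H₀_resolvent hz' x
  set u := resolvent H₀ z y
  set v := resolvent H₀ ((starRingEnd ℂ) z) x
  rw [← h1, ← h2, inner_sub_left, inner_sub_right, inner_smul_left, inner_smul_right,
    H₀_symmetric, Complex.conj_conj]

lemma norm_inner_resolvent_le {z : ℂ} (hz : 0 < z.im) (x y : L2Z) :
    ‖inner ℂ x (resolvent H₀ z y)‖ ≤ ‖x‖ * ‖y‖ / z.im := by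
  have h := norm_resolvent_H₀_le hz.ne' y
  rw [abs_of_pos hz] at h
  calc ‖inner ℂ x (resolvent H₀ z y)‖ ≤ ‖x‖ * ‖resolvent H₀ z y‖ := norm_inner_le_norm _ _
    _ ≤ ‖x‖ * (‖y‖ / z.im) := by gcongr
    _ = _ := by ring

/-! ### The limiting absorption principle -/

lemma norm_sub_le_of_norm_deriv_le {f f' : ℝ → ℂ} {B B' : ℝ → ℝ} {s : ℝ} (hs : s ≤ 1)
    (hf : ∀ t ∈ Set.Icc s 1, HasDerivAt f (f' t) t) (hB : ∀ t ∈ Set.Icc s 1, HasDerivAt B (B' t) t)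
    (h : ∀ t ∈ Set.Icc s 1, ‖f' t‖ ≤ B' t) : ‖f 1 - f s‖ ≤ B 1 - B s := by
  refine image_norm_le_of_norm_deriv_right_le_deriv_boundary' (f := fun t => f t - f s) (f' := f')
    (B := fun t => B t - B s) (B' := B') (a := s) (b := 1)
    (fun t ht => ((hf t ht).sub_const _).continuousAt.continuousWithinAt)
    (fun t ht => ((hf t (Set.Ico_subset_Icc_self ht)).sub_const _).hasDerivWithinAt)
    (by simp)
    (fun t ht => ((hB t ht).sub_const _).continuousAt.continuousWithinAt)
    (fun t ht => ((hB t (Set.Ico_subset_Icc_self ht)).sub_const _).hasDerivWithinAt)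
    (fun t ht => h t (Set.Ico_subset_Icc_self ht)) (Set.right_mem_Icc.2 hs)

lemma hasDerivAt_inner_resolvent (r : ℝ) {t : ℝ} (ht : 0 < t) (x y : L2Z) :
    HasDerivAt (fun t : ℝ => inner ℂ x (resolvent H₀ (⟨r, t⟩ : ℂ) y))
      (-Complex.I * inner ℂ x (resolvent H₀ (⟨r, t⟩ : ℂ) (resolvent H₀ (⟨r, t⟩ : ℂ) y))) t := by
  have h1 : HasDerivAt (resolvent H₀) (-resolvent H₀ (⟨r, t⟩ : ℂ) ^ 2) (⟨r, t⟩ : ℂ) :=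
    spectrum.hasDerivAt_resolvent_const_left
      (spectrum.notMem_iff.1 (notMem_spectrum_H₀ (z := ⟨r, t⟩) ht.ne'))
  have h2 : HasDerivAt (fun t : ℝ => (⟨r, t⟩ : ℂ)) Complex.I t := by
    have h := ((Complex.ofRealCLM.hasDerivAt (x := t)).mul_const Complex.I).const_add (r : ℂ)
    simp only [Complex.ofRealCLM_apply, Complex.ofReal_one, one_mul] at h
    convert! h using 1
    funext s
    exact Complex.mk_eq_add_mul_I r s
  have h3 := h1.scomp t h2
  have h4 := (((innerSL ℂ x).comp (ContinuousLinearMap.apply ℂ L2Z y)).restrictScalars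
    ℝ).hasFDerivAt.comp_hasDerivAt t h3
  convert! h4 using 1
  simp [sq, inner_smul_right]

/-- The differential inequality behind the limiting absorption principle: up to quantities without
a second resolvent, the derivative of the resolvent is controlled by its commutator with `A₀`. -/
lemma norm_inner_resolvent_sq_le {a b : ℝ} (ha : 0 < a) (hb : b < 4) {z : ℂ}
    (hre : z.re ∈ Set.Icc a b) (him : 0 < z.im) (him1 : z.im ≤ 1) {x x' y y' : L2Z}
    (hx : (x, x') ∈ A₀.graph) (hy : (y, y') ∈ A₀.graph) :
    ‖inner ℂ x (resolvent H₀ z (resolvent H₀ z y))‖ ≤ (a * (4 - b))⁻¹ *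
      (‖inner ℂ x' (resolvent H₀ z y)‖ + ‖inner ℂ x (resolvent H₀ z y')‖
        + 6 * ‖inner ℂ x (resolvent H₀ z y)‖ + ‖x‖ * ‖y‖) := by
  have hab : a ≤ b := hre.1.trans hre.2
  have hc : 0 < a * (4 - b) := mul_pos ha (by linarith)
  have hp : a * (4 - b) ≤ ‖z * (4 - z)‖ := by
    rw [norm_mul]
    refine mul_le_mul ?_ ?_ (by linarith) (norm_nonneg _)
    · exact hre.1.trans (Complex.re_le_norm z)
    · refine le_trans ?_ (Complex.re_le_norm _)
      rw [Complex.sub_re, Complex.re_ofNat]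
      linarith [hre.2]
  have h42 : ‖4 - 2 * z‖ ≤ 6 := by
    refine (Complex.norm_le_abs_re_add_abs_im _).trans ?_
    have h1 : |(4 - 2 * z).re| ≤ 4 := by
      simp only [Complex.sub_re, Complex.re_ofNat, Complex.mul_re, Complex.im_ofNat, zero_mul,
        sub_zero]
      rw [abs_le]; constructor <;> linarith [hre.1, hre.2]
    have h2 : |(4 - 2 * z).im| ≤ 2 := by
      simp only [Complex.sub_im, Complex.im_ofNat, Complex.mul_im, Complex.re_ofNat, zero_mul,
        add_zero, zero_sub]
      rw [abs_le]; constructor <;> linarith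
    linarith
  have hcomm := commutator_resolvent him.ne' hx hy
  set Q := resolvent H₀ z
  have hI : Complex.I * Complex.I = -1 := Complex.I_mul_I
  have heq : z * (4 - z) * inner ℂ x (Q (Q y))
      = Complex.I * (inner ℂ x' (Q y) - inner ℂ x (Q y')) + (4 - 2 * z) * inner ℂ x (Q y)
        + inner ℂ x y := by
    rw [hcomm]
    linear_combination ((z * (4 - z) * inner ℂ x (Q (Q y))
        - (4 - 2 * z) * inner ℂ x (Q y) - inner ℂ x y)) * hI
  rw [inv_mul_eq_div, le_div_iff₀ hc, mul_comm]
  calc a * (4 - b) * ‖inner ℂ x (Q (Q y))‖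
      ≤ ‖z * (4 - z)‖ * ‖inner ℂ x (Q (Q y))‖ := by gcongr
    _ = ‖Complex.I * (inner ℂ x' (Q y) - inner ℂ x (Q y')) + (4 - 2 * z) * inner ℂ x (Q y)
        + inner ℂ x y‖ := by rw [← norm_mul, heq]
    _ ≤ (‖inner ℂ x' (Q y)‖ + ‖inner ℂ x (Q y')‖) + 6 * ‖inner ℂ x (Q y)‖ + ‖x‖ * ‖y‖ := by
        refine (norm_add₃_le).trans ?_
        rw [norm_mul, norm_mul, Complex.norm_I, one_mul]
        gcongr
        · exact norm_sub_le _ _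
        · exact norm_inner_le_norm x y

/-- The first integration of the differential inequality improves the trivial bound `1 / Im z` to
`1 / √(Im z)`. -/
lemma norm_inner_resolvent_le_inv_sqrt {a b : ℝ} (ha : 0 < a) (hb : b < 4) {r s : ℝ}
    (hr : r ∈ Set.Icc a b) (hs : s ∈ Set.Ioc (0 : ℝ) 1) {x x' y y' : L2Z}
    (hx : (x, x') ∈ A₀.graph) (hy : (y, y') ∈ A₀.graph) {X Y : ℝ} (hX : ‖x‖ ≤ X) (hX' : ‖x'‖ ≤ X)
    (hY : ‖y‖ ≤ Y) (hY' : ‖y'‖ ≤ Y) :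
    ‖inner ℂ x (resolvent H₀ (⟨r, s⟩ : ℂ) y)‖ ≤ (1 + 18 * (a * (4 - b))⁻¹) * (X * Y) / √s := by
  have hc : 0 < (a * (4 - b))⁻¹ :=
    inv_pos.2 (mul_pos ha (by linarith [hr.1, hr.2]))
  set c := (a * (4 - b))⁻¹
  have hX0 : 0 ≤ X := (norm_nonneg _).trans hX
  have hY0 : 0 ≤ Y := (norm_nonneg _).trans hY
  have htriv : ∀ {t : ℝ}, 0 < t → ∀ {u v : L2Z}, ‖u‖ ≤ X → ‖v‖ ≤ Y →
      ‖inner ℂ u (resolvent H₀ (⟨r, t⟩ : ℂ) v)‖ ≤ X * Y / t := by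
    intro t ht u v hu hv
    refine (norm_inner_resolvent_le (z := ⟨r, t⟩) ht u v).trans ?_
    gcongr
  -- the derivative is at most `9 c X Y / t`, which is weakened to `9 c X Y / (t √t)` so that the
  -- primitive is a power
  have hmain := norm_sub_le_of_norm_deriv_le (s := s) hs.2
    (f := fun t : ℝ => inner ℂ x (resolvent H₀ (⟨r, t⟩ : ℂ) y))
    (B := fun t => -(18 * c * (X * Y)) * (√t)⁻¹)
    (B' := fun t => 9 * c * (X * Y) / (t * √t))
    (fun t ht => hasDerivAt_inner_resolvent r (hs.1.trans_le ht.1) x y)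
    (fun t ht => by
      have ht0 : 0 < t := hs.1.trans_le ht.1
      have hq : √t ≠ 0 := (Real.sqrt_pos.2 ht0).ne'
      have h := ((Real.hasDerivAt_sqrt ht0.ne').inv hq).const_mul (-(18 * c * (X * Y)))
      convert! h using 1
      rw [Real.sq_sqrt ht0.le]
      field_simp
      ring)
    (fun t ht => by
      have ht0 : 0 < t := hs.1.trans_le ht.1
      rw [norm_mul, norm_neg, Complex.norm_I, one_mul]
      refine (norm_inner_resolvent_sq_le ha hb (z := ⟨r, t⟩) hr ht0 ht.2 hx hy).trans ?_
      have h1 := htriv ht0 hX' hY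
      have h2 := htriv ht0 hX hY'
      have h3 := htriv ht0 hX hY
      have h4 : ‖x‖ * ‖y‖ ≤ X * Y / t := by
        rw [le_div_iff₀ ht0]
        calc ‖x‖ * ‖y‖ * t ≤ X * Y * 1 := by gcongr; exact ht.2
          _ = X * Y := mul_one _
      calc c * (‖inner ℂ x' (resolvent H₀ (⟨r, t⟩ : ℂ) y)‖
            + ‖inner ℂ x (resolvent H₀ (⟨r, t⟩ : ℂ) y')‖
            + 6 * ‖inner ℂ x (resolvent H₀ (⟨r, t⟩ : ℂ) y)‖ + ‖x‖ * ‖y‖)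
          ≤ c * (9 * (X * Y / t)) := mul_le_mul_of_nonneg_left (by linarith) hc.le
        _ = 9 * c * (X * Y) / t := by ring
        _ ≤ _ := by
            refine div_le_div_of_nonneg_left (by positivity) (by positivity) ?_
            exact mul_le_of_le_one_right ht0.le (Real.sqrt_le_one.2 ht.2))
  have h1 := htriv one_pos hX hY
  have hq : 0 < √s := Real.sqrt_pos.2 hs.1
  have hq1 : √s ≤ 1 := Real.sqrt_le_one.2 hs.2
  simp only [Real.sqrt_one, inv_one, mul_one, div_one] at hmain h1
  have h2 : ‖inner ℂ x (resolvent H₀ (⟨r, s⟩ : ℂ) y)‖ ≤ X * Y + 18 * c * (X * Y) * (√s)⁻¹ := by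
    have h3 := norm_le_norm_add_norm_sub (inner ℂ x (resolvent H₀ (⟨r, 1⟩ : ℂ) y))
      (inner ℂ x (resolvent H₀ (⟨r, s⟩ : ℂ) y))
    have h4 : 0 ≤ 18 * c * (X * Y) := by positivity
    linarith
  refine h2.trans ?_
  rw [le_div_iff₀ hq, add_mul, mul_assoc (18 * c * (X * Y)), inv_mul_cancel₀ hq.ne', mul_one]
  have : X * Y * √s ≤ X * Y := mul_le_of_le_one_right (by positivity) hq1
  linarith

/-- The limiting absorption principle for `H₀`, on the domain of `A₀²`. -/
theorem limiting_absorption_H₀ {a b : ℝ} (ha : 0 < a) (hb : b < 4) :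
    ∃ C : ℝ, 0 ≤ C ∧ ∀ z : ℂ, z.re ∈ Set.Icc a b → z.im ≠ 0 → |z.im| ≤ 1 →
      ∀ x x' x'' y y' y'' : L2Z, (x, x') ∈ A₀.graph → (x', x'') ∈ A₀.graph →
        (y, y') ∈ A₀.graph → (y', y'') ∈ A₀.graph →
        ‖inner ℂ x (resolvent H₀ z y)‖
          ≤ C * ((‖x‖ + ‖x'‖ + ‖x''‖) * (‖y‖ + ‖y'‖ + ‖y''‖)) := by
  have hc : 0 < (a * (4 - b))⁻¹ := inv_pos.2 (mul_pos ha (by linarith))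
  set c := (a * (4 - b))⁻¹ with hcdef
  set A := 1 + 18 * c with hA
  have hA1 : 1 ≤ A := by linarith
  have upper : ∀ z : ℂ, z.re ∈ Set.Icc a b → 0 < z.im → z.im ≤ 1 →
      ∀ x x' x'' y y' y'' : L2Z, (x, x') ∈ A₀.graph → (x', x'') ∈ A₀.graph →
        (y, y') ∈ A₀.graph → (y', y'') ∈ A₀.graph →
        ‖inner ℂ x (resolvent H₀ z y)‖
          ≤ (1 + 18 * c * A) * ((‖x‖ + ‖x'‖ + ‖x''‖) * (‖y‖ + ‖y'‖ + ‖y''‖)) := by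
    rintro ⟨r, s⟩ hr hs hs1 x x' x'' y y' y'' hx hx' hy hy'
    simp only at hr hs hs1
    set X := ‖x‖ + ‖x'‖ + ‖x''‖ with hX
    set Y := ‖y‖ + ‖y'‖ + ‖y''‖ with hY
    have hX0 : ‖x‖ ≤ X := by rw [hX]; linarith [norm_nonneg x', norm_nonneg x'']
    have hX1 : ‖x'‖ ≤ X := by rw [hX]; linarith [norm_nonneg x, norm_nonneg x'']
    have hX2 : ‖x''‖ ≤ X := by rw [hX]; linarith [norm_nonneg x, norm_nonneg x']
    have hY0 : ‖y‖ ≤ Y := by rw [hY]; linarith [norm_nonneg y', norm_nonneg y'']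
    have hY1 : ‖y'‖ ≤ Y := by rw [hY]; linarith [norm_nonneg y, norm_nonneg y'']
    have hY2 : ‖y''‖ ≤ Y := by rw [hY]; linarith [norm_nonneg y, norm_nonneg y']
    have hXp : 0 ≤ X := (norm_nonneg _).trans hX0
    have hYp : 0 ≤ Y := (norm_nonneg _).trans hY0
    have hmain := norm_sub_le_of_norm_deriv_le (s := s) hs1
      (f := fun t : ℝ => inner ℂ x (resolvent H₀ (⟨r, t⟩ : ℂ) y))
      (B := fun t => 18 * c * A * (X * Y) * √t)
      (B' := fun t => 9 * c * A * (X * Y) / √t)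
      (fun t ht => hasDerivAt_inner_resolvent r (hs.trans_le ht.1) x y)
      (fun t ht => by
        have ht0 : 0 < t := hs.trans_le ht.1
        have hq : √t ≠ 0 := (Real.sqrt_pos.2 ht0).ne'
        convert! (Real.hasDerivAt_sqrt ht0.ne').const_mul (18 * c * A * (X * Y)) using 1
        field_simp
        ring)
      (fun t ht => by
        have ht0 : 0 < t := hs.trans_le ht.1
        have htm : t ∈ Set.Ioc (0 : ℝ) 1 := ⟨ht0, ht.2⟩
        have hq : 0 < √t := Real.sqrt_pos.2 ht0
        have hq1 : √t ≤ 1 := Real.sqrt_le_one.2 ht.2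
        rw [norm_mul, norm_neg, Complex.norm_I, one_mul]
        refine (norm_inner_resolvent_sq_le ha hb (z := ⟨r, t⟩) hr ht0 ht.2 hx hy).trans ?_
        have h1 := norm_inner_resolvent_le_inv_sqrt ha hb hr htm hx' hy hX1 hX2 hY0 hY1
        have h2 := norm_inner_resolvent_le_inv_sqrt ha hb hr htm hx hy' hX0 hX1 hY1 hY2
        have h3 := norm_inner_resolvent_le_inv_sqrt ha hb hr htm hx hy hX0 hX1 hY0 hY1
        rw [← hcdef, ← hA] at h1 h2 h3
        have h4 : ‖x‖ * ‖y‖ ≤ A * (X * Y) / √t := by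
          rw [le_div_iff₀ hq]
          calc ‖x‖ * ‖y‖ * √t ≤ X * Y * 1 := by gcongr
            _ ≤ A * (X * Y) := by nlinarith [mul_nonneg hXp hYp]
        calc c * (‖inner ℂ x' (resolvent H₀ (⟨r, t⟩ : ℂ) y)‖
            + ‖inner ℂ x (resolvent H₀ (⟨r, t⟩ : ℂ) y')‖
              + 6 * ‖inner ℂ x (resolvent H₀ (⟨r, t⟩ : ℂ) y)‖ + ‖x‖ * ‖y‖)
            ≤ c * (9 * (A * (X * Y) / √t)) := mul_le_mul_of_nonneg_left (by linarith) hc.le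
          _ = _ := by ring)
    have h1 : ‖inner ℂ x (resolvent H₀ (⟨r, 1⟩ : ℂ) y)‖ ≤ X * Y := by
      refine (norm_inner_resolvent_le (z := ⟨r, 1⟩) one_pos x y).trans ?_
      simp only [div_one]
      gcongr
    have h2 := norm_le_norm_add_norm_sub (inner ℂ x (resolvent H₀ (⟨r, 1⟩ : ℂ) y))
      (inner ℂ x (resolvent H₀ (⟨r, s⟩ : ℂ) y))
    simp only [Real.sqrt_one, mul_one] at hmain
    have h3 : 0 ≤ 18 * c * A * (X * Y) * √s := by positivity
    linarith
  refine ⟨1 + 18 * c * A, by positivity, fun z hre him him1 x x' x'' y y' y'' hx hx' hy hy' => ?_⟩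
  -- the lower half plane follows from the upper one by taking adjoints
  rcases lt_or_gt_of_ne him with h | h
  · rw [inner_resolvent_conj him, ← norm_inner_symm, mul_comm (‖x‖ + _ + _)]
    exact upper _ (by simpa using hre) (by simpa using h)
      (by rw [Complex.conj_im]; rwa [abs_of_neg h] at him1) _ _ _ _ _ _ hy hy' hx hx'
  · exact upper z hre h (by rwa [abs_of_pos h] at him1) _ _ _ _ _ _ hx hx' hy hy'

/-- Weighted form of the limiting absorption principle: the basis vectors are in the domain of `A₀²`
with polynomially growing graph norms, so an exponential weight makes the resolvent bounded. -/
theorem limiting_absorption_weight {a b : ℝ} (ha : 0 < a) (hb : b < 4) {q : ℝ}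
    (h0 : 0 ≤ q) (h1 : q < 1) :
    ∃ C : ℝ, ∀ z : ℂ, z.re ∈ Set.Icc a b → z.im ≠ 0 → |z.im| ≤ 1 →
      ∀ y y' y'' : L2Z, (y, y') ∈ A₀.graph → (y', y'') ∈ A₀.graph →
        ‖weight q (resolvent H₀ z y)‖ ≤ C * (‖y‖ + ‖y'‖ + ‖y''‖) := by
  obtain ⟨C, hC, h⟩ := limiting_absorption_H₀ ha hb
  have hs : Summable fun n : ℤ => q ^ n.natAbs * (10 * ((n.natAbs : ℝ) ^ 2 + 1)) := by
    refine (((summable_pow_natAbs h0 h1 2).add (summable_geom_natAbs h0 h1)).mul_left 10).congr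
      fun n => ?_
    ring
  refine ⟨C * ∑' n : ℤ, q ^ n.natAbs * (10 * ((n.natAbs : ℝ) ^ 2 + 1)),
    fun z hre him him1 y y' y'' hy hy' => ?_⟩
  set Y := ‖y‖ + ‖y'‖ + ‖y''‖ with hY
  have hY0 : 0 ≤ Y := by positivity
  have hs2 : Summable fun n : ℤ => q ^ n.natAbs * (C * Y * (10 * ((n.natAbs : ℝ) ^ 2 + 1))) :=
    (hs.mul_left (C * Y)).congr fun n => by ring
  refine (norm_weight_apply_le h0 h1 _ hs2 fun n => ?_).trans_eq ?_
  · rw [← inner_e_left]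
    refine (h z hre him him1 _ _ _ _ _ _ (e_mem_graph n) (A₀e_mem_graph n) hy hy').trans ?_
    have hn : ‖e n‖ + ‖A₀e n‖ + ‖A₀A₀e n‖ ≤ 10 * ((n.natAbs : ℝ) ^ 2 + 1) := by
      have h1 := norm_A₀e_le n
      have h2 := norm_A₀A₀e_le n
      rw [norm_e]
      nlinarith [sq_nonneg ((n.natAbs : ℝ) - 1)]
    calc C * ((‖e n‖ + ‖A₀e n‖ + ‖A₀A₀e n‖) * Y) ≤ C * (10 * ((n.natAbs : ℝ) ^ 2 + 1) * Y) := by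
          gcongr
      _ = _ := by ring
  · rw [mul_right_comm, ← tsum_mul_left]
    exact tsum_congr fun n => by ring

/-! ### The resolvent of the perturbed operator -/

/-- The algebra behind the resolvent formula: if `L = Q⁻¹` and `N = (1 - K W Q W)⁻¹`, then
`L - W K W` has the inverse `Q + Q W N K W Q`. -/
lemma mul_eq_one_of_weighted_perturbation {R : Type*} [Ring R] {L Q W K N : R} (hLQ : L * Q = 1)
    (hQL : Q * L = 1) (hMN : (1 - K * (W * Q * W)) * N = 1) (hNM : N * (1 - K * (W * Q * W)) = 1) :
    (L - W * K * W) * (Q + Q * W * N * K * W * Q) = 1 ∧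
      (Q + Q * W * N * K * W * Q) * (L - W * K * W) = 1 := by
  have h1 : K * (W * Q * W) * N = N - 1 := by rw [← hMN]; noncomm_ring
  have h2 : N * (K * (W * Q * W)) = N - 1 := by rw [← hNM]; noncomm_ring
  constructor
  · calc (L - W * K * W) * (Q + Q * W * N * K * W * Q)
        = L * Q + L * Q * (W * N * K * W * Q) - W * K * W * Q
          - W * (K * (W * Q * W) * N) * (K * W * Q) := by noncomm_ring
      _ = 1 := by rw [hLQ, h1]; noncomm_ring
  · calc (Q + Q * W * N * K * W * Q) * (L - W * K * W)
        = Q * L + Q * W * N * K * W * (Q * L) - Q * W * K * W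
          - Q * W * (N * (K * (W * Q * W))) * (K * W) := by noncomm_ring
      _ = 1 := by rw [hQL, h2]; noncomm_ring

/-- The resolvent of the perturbed operator in terms of the free one and of the inverse of
`1 + K T(w)`. -/
lemma resolvent_H_eq {s : ℝ} (hs0 : 0 < s) (hs1 : s < 1) (K : L2Z →L[ℂ] L2Z) {w : ℂ} (h0 : w ≠ 0)
    (h1 : ‖w‖ < 1) (hu : IsUnit (1 + K * weightedResolvent s w)) :
    joukowski w ∉ spectrum ℂ (H (weight (s ^ 2) * K * weight (s ^ 2))) ∧
      resolvent (H (weight (s ^ 2) * K * weight (s ^ 2))) (joukowski w)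
        = resolvent H₀ (joukowski w) + resolvent H₀ (joukowski w) * weight (s ^ 2)
          * Ring.inverse (1 + K * weightedResolvent s w) * K * weight (s ^ 2)
          * resolvent H₀ (joukowski w) := by
  have hL := isUnit_sub_H₀ h0 h1
  have hM : 1 + K * weightedResolvent s w
      = 1 - K * (weight (s ^ 2) * resolvent H₀ (joukowski w) * weight (s ^ 2)) := by
    rw [weightedResolvent_eq hs0 hs1 h0 h1, mul_neg, sub_eq_add_neg]
  have hMN := Ring.mul_inverse_cancel _ hu
  have hNM := Ring.inverse_mul_cancel _ hu
  set N := Ring.inverse (1 + K * weightedResolvent s w)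
  rw [hM] at hMN hNM
  obtain ⟨e1, e2⟩ := mul_eq_one_of_weighted_perturbation (Ring.mul_inverse_cancel _ hL)
    (Ring.inverse_mul_cancel _ hL) hMN hNM
  have hsub : algebraMap ℂ (L2Z →L[ℂ] L2Z) (joukowski w)
      - H (weight (s ^ 2) * K * weight (s ^ 2))
      = algebraMap ℂ (L2Z →L[ℂ] L2Z) (joukowski w) - H₀ - weight (s ^ 2) * K * weight (s ^ 2) := by
    rw [H, sub_sub]
  refine ⟨?_, ?_⟩
  · rw [spectrum.notMem_iff, hsub]
    exact ⟨⟨_, _, e1, e2⟩, rfl⟩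
  · rw [resolvent, hsub]
    exact Ring.inverse_unit ⟨_, _, e1, e2⟩

lemma weight_symmetric {q : ℝ} (h0 : 0 ≤ q) (h1 : q < 1) (x y : L2Z) :
    inner ℂ (weight q x) y = inner ℂ x (weight q y) := by
  rw [lp.inner_eq_tsum, lp.inner_eq_tsum]
  refine tsum_congr fun n => ?_
  rw [weight_apply h0 h1, weight_apply h0 h1, RCLike.inner_apply, RCLike.inner_apply, map_mul,
    map_pow, Complex.conj_ofReal]
  ring

/-! ### Zeros of the determinant and the discrete spectrum -/

lemma finite_zeros_closedBall {d : ℂ → ℂ} {r ρ : ℝ} (hr : 0 ≤ r) (hρ : r < ρ)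
    (hd : DifferentiableOn ℂ d (Metric.ball 0 ρ)) (h0 : d 0 ≠ 0) :
    {w ∈ Metric.closedBall (0 : ℂ) r | d w = 0}.Finite := by
  by_contra hinf
  obtain ⟨w, hw, hacc⟩ := Set.Infinite.exists_accPt_of_subset_isCompact hinf
    (isCompact_closedBall (0 : ℂ) r) (Set.sep_subset _ _)
  have hf : ∃ᶠ v in 𝓝[≠] w, d v = 0 :=
    (accPt_iff_frequently_nhdsNE.1 hacc).mono fun v hv => hv.2
  have hsub := Metric.closedBall_subset_ball (x := (0 : ℂ)) hρ
  exact h0 ((hd.analyticOnNhd Metric.isOpen_ball).eqOn_zero_of_preconnected_of_frequently_eq_zero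
    (convex_ball (0 : ℂ) ρ).isPreconnected (hsub hw) hf (hsub (Metric.mem_closedBall_self hr)))

/-- No point of `[0, 4]` is isolated in the spectrum. -/
lemma notMem_discreteSpectrum_of_mem_Icc {L : L2Z →L[ℂ] L2Z}
    (hL : ∀ x : ℝ, x ∈ Set.Icc (0 : ℝ) 4 → (x : ℂ) ∈ spectrum ℂ L) {x : ℝ}
    (hx : x ∈ Set.Icc (0 : ℝ) 4) : (x : ℂ) ∉ discreteSpectrum L := by
  rintro ⟨_, r, hr, hiso, _⟩
  have key : ∀ y : ℝ, y ∈ Set.Icc (0 : ℝ) 4 → |y - x| ≤ r → y = x := by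
    intro y hy hxy
    have : (y : ℂ) ∈ spectrum ℂ L ∩ Metric.closedBall (x : ℂ) r := by
      refine ⟨hL y hy, ?_⟩
      rw [Metric.mem_closedBall, dist_eq_norm, ← Complex.ofReal_sub, Complex.norm_real]
      exact hxy
    rw [hiso] at this
    exact_mod_cast Set.mem_singleton_iff.1 this
  have hm : 0 < min r 1 := lt_min hr one_pos
  have hm1 := min_le_right r 1
  have hmr := min_le_left r 1
  rcases le_total x 2 with h | h
  · have := key (x + min r 1) ⟨by linarith [hx.1], by linarith⟩
      (by rw [add_sub_cancel_left, abs_of_pos hm]; exact hmr)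
    linarith
  · have := key (x - min r 1) ⟨by linarith, by linarith [hx.2]⟩
      (by rw [sub_sub_cancel_left, abs_neg, abs_of_pos hm]; exact hmr)
    linarith

/-! ### Uniform invertibility near the continuous spectrum -/

lemma exists_Icc_of_isCompact_subset_Ioo {K : Set ℝ} (hK : IsCompact K) {l u : ℝ} (hlu : l < u)
    (h : K ⊆ Set.Ioo l u) : ∃ a b, l < a ∧ b < u ∧ K ⊆ Set.Icc a b := by
  rcases K.eq_empty_or_nonempty with rfl | hne
  · exact ⟨u, l, hlu, hlu, Set.empty_subset _⟩
  · obtain ⟨a, ha, ha'⟩ := hK.exists_isLeast hne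
    obtain ⟨b, hb, hb'⟩ := hK.exists_isGreatest hne
    exact ⟨a, b, (h ha).1, (h hb).2, fun x hx => ⟨ha' hx, hb' hx⟩⟩

lemma continuousOn_joukowski : ContinuousOn joukowski {w | w ≠ 0} := by
  intro w hw
  unfold joukowski
  have hw : w ≠ 0 := hw
  exact ContinuousAt.continuousWithinAt (by fun_prop (disch := exact hw))

/-- The part of the closed unit disc, away from the origin, which parametrizes the points with real
part in `Δ` and imaginary part at most `t` in absolute value. -/
def diskStrip (Δ : Set ℝ) (t : ℝ) : Set ℂ :=
  {w | w ∈ Metric.closedBall (0 : ℂ) 1 \ Metric.ball 0 (1 / 8) ∧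
    (joukowski w).re ∈ Δ ∧ |(joukowski w).im| ≤ t}

lemma ne_zero_of_mem_annulus {w : ℂ}
    (hw : w ∈ Metric.closedBall (0 : ℂ) 1 \ Metric.ball 0 (1 / 8)) : w ≠ 0 := by
  rintro rfl
  exact hw.2 (Metric.mem_ball_self (by norm_num))

lemma isCompact_diskStrip {Δ : Set ℝ} (hΔ : IsClosed Δ) (t : ℝ) : IsCompact (diskStrip Δ t) := by
  have hA : IsCompact (Metric.closedBall (0 : ℂ) 1 \ Metric.ball 0 (1 / 8)) :=
    (isCompact_closedBall _ _).diff Metric.isOpen_ball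
  have hcl : IsClosed {z : ℂ | z.re ∈ Δ ∧ |z.im| ≤ t} :=
    (hΔ.preimage Complex.continuous_re).inter
      (isClosed_le Complex.continuous_im.abs continuous_const)
  have hc := (continuousOn_joukowski.mono fun w hw => ne_zero_of_mem_annulus hw)
    |>.preimage_isClosed_of_isClosed hA.isClosed hcl
  exact hA.of_isClosed_subset hc Set.inter_subset_left

lemma mem_diskStrip {Δ : Set ℝ} (hΔ : Δ ⊆ Set.Ioo 0 4) {t : ℝ} (ht : t ≤ 1) {w : ℂ} (h0 : w ≠ 0)
    (h1 : ‖w‖ ≤ 1) (hre : (joukowski w).re ∈ Δ) (him : |(joukowski w).im| ≤ t) :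
    w ∈ diskStrip Δ t := by
  refine ⟨⟨mem_closedBall_zero_iff.2 h1, fun hb => ?_⟩, hre, him⟩
  rw [mem_ball_zero_iff] at hb
  have hz : ‖joukowski w‖ ≤ 5 := by
    refine (Complex.norm_le_abs_re_add_abs_im _).trans ?_
    rw [abs_of_pos (hΔ hre).1]
    linarith [(hΔ hre).2]
  have hinv : ‖w⁻¹‖ ≤ 8 := by
    have : w⁻¹ = 2 - w - joukowski w := by rw [joukowski]; ring
    rw [this]
    refine (norm_sub_le _ _).trans ?_
    have h2 := norm_sub_le (2 : ℂ) w
    rw [Complex.norm_two] at h2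
    linarith
  rw [norm_inv, inv_le_comm₀ (norm_pos_iff.2 h0) (by norm_num)] at hinv
  linarith

/-- Near the part of the boundary which lies over `Δ`, the family `1 + K T(w)` is invertible with a
uniformly bounded inverse, as soon as it is invertible on the boundary. -/
lemma exists_uniform_bound_inverse {s : ℝ} (hs0 : 0 < s) (hs1 : s < 1) (K : L2Z →L[ℂ] L2Z)
    {Δ : Set ℝ} (hΔ : IsClosed Δ) (hΔ4 : Δ ⊆ Set.Ioo 0 4)
    (hreg : ∀ w : ℂ, ‖w‖ = 1 → 2 - 2 * w.re ∈ Δ → 1 - w ^ 2 ≠ 0 →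
      IsUnit (1 + K * weightedResolvent s w)) :
    ∃ t : ℝ, 0 < t ∧ t ≤ 1 ∧ ∃ B : ℝ, ∀ w ∈ diskStrip Δ t,
      IsUnit (1 + K * weightedResolvent s w) ∧
        ‖Ring.inverse (1 + K * weightedResolvent s w)‖ ≤ B := by
  set U : Set ℂ := Metric.ball 0 s⁻¹ ∩ {w | 1 - w ^ 2 ≠ 0} with hU
  have hUo : IsOpen U := Metric.isOpen_ball.inter
    (isOpen_ne_fun (by fun_prop) continuous_const)
  have hMc : ContinuousOn (fun w => 1 + K * weightedResolvent s w) U :=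
    continuousOn_const.add (continuousOn_const.mul
      (differentiableOn_weightedResolvent hs0 hs1).continuousOn)
  set G : Set ℂ := U ∩ (fun w => 1 + K * weightedResolvent s w) ⁻¹' {T | IsUnit T} with hG
  have hGo : IsOpen G := hMc.isOpen_inter_preimage hUo Units.isOpen
  have hreal : ∀ w ∈ diskStrip Δ 1, (joukowski w).im = 0 → w ∈ G := by
    intro w hw him
    have hw0 := ne_zero_of_mem_annulus hw.1
    have hx : joukowski w = (((joukowski w).re : ℝ) : ℂ) :=
      Complex.ext rfl (by rw [him, Complex.ofReal_im])
    have h01 := hΔ4 hw.2.1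
    have hn : ‖w‖ = 1 := by
      refine le_antisymm (mem_closedBall_zero_iff.1 hw.1.1) (not_lt.1 fun hlt => ?_)
      exact joukowski_notMem_Icc hw0 hlt (Set.Ioo_subset_Icc_self h01) hx
    have hre : (joukowski w).re = 2 - 2 * w.re := by
      rw [joukowski_eq_of_norm_eq_one hn, Complex.ofReal_re]
    have hsq : 1 - w ^ 2 ≠ 0 := by
      intro h
      have h1 : (w - 1) * (w + 1) = 0 := by linear_combination -h
      rcases mul_eq_zero.1 h1 with h2 | h2
      · have hw1 : w = 1 := sub_eq_zero.1 h2
        rw [hre, hw1, Complex.one_re] at h01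
        linarith [h01.1]
      · have hw1 : w = -1 := eq_neg_of_add_eq_zero_left h2
        rw [hre, hw1, Complex.neg_re, Complex.one_re] at h01
        linarith [h01.2]
    refine ⟨⟨mem_ball_zero_iff.2 (hn.trans_lt ((one_lt_inv₀ hs0).2 hs1)), hsq⟩, ?_⟩
    exact hreg w hn (hre ▸ hw.2.1) hsq
  -- off the good set the imaginary part is bounded below, by compactness
  obtain ⟨δ, hδ, hδB⟩ : ∃ δ : ℝ, 0 < δ ∧ ∀ w ∈ diskStrip Δ 1 \ G, δ ≤ |(joukowski w).im| := by
    have hBc := (isCompact_diskStrip hΔ 1).diff hGo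
    rcases (diskStrip Δ 1 \ G).eq_empty_or_nonempty with h | h
    · exact ⟨1, one_pos, fun w hw => by rw [h] at hw; exact hw.elim⟩
    · have hc : ContinuousOn (fun w => |(joukowski w).im|) (diskStrip Δ 1 \ G) :=
        (Complex.continuous_im.comp_continuousOn
          (continuousOn_joukowski.mono fun w hw => ne_zero_of_mem_annulus hw.1.1)).abs
      obtain ⟨w, hw, hmin⟩ := hBc.exists_isMinOn h hc
      exact ⟨|(joukowski w).im|, abs_pos.2 fun h0 => hw.2 (hreal w hw.1 h0), fun v hv => hmin hv⟩
  have ht0 : 0 < min 1 (δ / 2) := lt_min one_pos (by linarith)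
  have hsub : diskStrip Δ (min 1 (δ / 2)) ⊆ G := by
    intro w hw
    by_contra hwG
    have h1 := hδB w ⟨⟨hw.1, hw.2.1, hw.2.2.trans (min_le_left _ _)⟩, hwG⟩
    have h2 := hw.2.2.trans (min_le_right _ _)
    linarith
  have hinv : ContinuousOn (fun w => Ring.inverse (1 + K * weightedResolvent s w))
      (diskStrip Δ (min 1 (δ / 2))) := by
    intro w hw
    obtain ⟨u, hu⟩ : IsUnit (1 + K * weightedResolvent s w) := (hsub hw).2
    have h1 : ContinuousAt Ring.inverse (1 + K * weightedResolvent s w) := by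
      rw [← hu]; exact NormedRing.inverse_continuousAt u
    exact h1.comp_continuousWithinAt (f := fun w => 1 + K * weightedResolvent s w)
      ((hMc w (hsub hw).1).mono fun v hv => (hsub hv).1)
  obtain ⟨B, hB⟩ := (isCompact_diskStrip hΔ _).exists_bound_of_continuousOn hinv
  exact ⟨_, ht0, min_le_left _ _, B, fun w hw => ⟨(hsub hw).2, hB w hw⟩⟩

/-- Boundedness of the matrix elements of the perturbed resolvent between vectors in the domain of
`A₀²`, wherever the inverse of `1 + K T(w)` is bounded. -/
lemma norm_inner_resolvent_H_le {s : ℝ} (hs0 : 0 < s) (hs1 : s < 1) (K : L2Z →L[ℂ] L2Z) {a b : ℝ}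
    (ha : 0 < a) (hb : b < 4) (B : ℝ) {x x' x'' y y' y'' : L2Z} (hx : (x, x') ∈ A₀.graph)
    (hx' : (x', x'') ∈ A₀.graph) (hy : (y, y') ∈ A₀.graph) (hy' : (y', y'') ∈ A₀.graph) :
    ∃ M : ℝ, ∀ w : ℂ, w ≠ 0 → ‖w‖ < 1 → (joukowski w).re ∈ Set.Icc a b →
      (joukowski w).im ≠ 0 → |(joukowski w).im| ≤ 1 → IsUnit (1 + K * weightedResolvent s w) →
      ‖Ring.inverse (1 + K * weightedResolvent s w)‖ ≤ B →
      ‖inner ℂ x (resolvent (H (weight (s ^ 2) * K * weight (s ^ 2))) (joukowski w) y)‖ ≤ M := by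
  have hq0 : 0 ≤ s ^ 2 := by positivity
  have hq1 : s ^ 2 < 1 := pow_lt_one₀ hs0.le hs1 two_ne_zero
  obtain ⟨C₁, -, h₁⟩ := limiting_absorption_H₀ ha hb
  obtain ⟨C₂, h₂⟩ := limiting_absorption_weight ha hb hq0 hq1
  refine ⟨C₁ * ((‖x‖ + ‖x'‖ + ‖x''‖) * (‖y‖ + ‖y'‖ + ‖y''‖))
    + C₂ * (‖x‖ + ‖x'‖ + ‖x''‖) * (B * (‖K‖ * (C₂ * (‖y‖ + ‖y'‖ + ‖y''‖)))),
    fun w h0 h1 hre him him1 hu hB => ?_⟩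
  rw [(resolvent_H_eq hs0 hs1 K h0 h1 hu).2]
  have hre' : ((starRingEnd ℂ) (joukowski w)).re ∈ Set.Icc a b := by simpa using hre
  have him' : ((starRingEnd ℂ) (joukowski w)).im ≠ 0 := by simpa using him
  have him1' : |((starRingEnd ℂ) (joukowski w)).im| ≤ 1 := by simpa using him1
  have hX := h₂ _ hre' him' him1' x x' x'' hx hx'
  have hY := h₂ _ hre him him1 y y' y'' hy hy'
  simp only [add_apply, mul_apply_eq_comp, inner_add_right]
  refine (norm_add_le _ _).trans (add_le_add (h₁ _ hre him him1 _ _ _ _ _ _ hx hx' hy hy') ?_)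
  rw [inner_resolvent_conj him, ← weight_symmetric hq0 hq1]
  have hB0 : 0 ≤ B := (norm_nonneg _).trans hB
  refine (norm_inner_le_norm _ _).trans
    (mul_le_mul hX ?_ (norm_nonneg _) ((norm_nonneg _).trans hX))
  refine (ContinuousLinearMap.le_opNorm _ _).trans (mul_le_mul hB ?_ (norm_nonneg _) hB0)
  exact (K.le_opNorm _).trans (mul_le_mul_of_nonneg_left hY (norm_nonneg _))

lemma joukowski_re_mem_Icc {w : ℂ} (hw : ‖w‖ = 1) : 2 - 2 * w.re ∈ Set.Icc (0 : ℝ) 4 := by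
  have h := abs_le.1 ((Complex.abs_re_le_norm w).trans_eq hw)
  exact ⟨by linarith [h.2], by linarith [h.1]⟩

end DiscreteSchrodinger

end

open DiscreteSchrodinger in
theorem mainTheorem4 (V : DiscreteSchrodinger.L2Z →L[ℂ] DiscreteSchrodinger.L2Z)
    (hV : DiscreteSchrodinger.ExpDecay V) :
    (∀ x : ℝ, x ∈ Set.Icc (0 : ℝ) 4 →
      ¬ AccPt (x : ℂ) (Filter.principal
        (DiscreteSchrodinger.discreteSpectrum (DiscreteSchrodinger.H V)))) ∧
    (DiscreteSchrodinger.discreteSpectrum (DiscreteSchrodinger.H V)).Finite ∧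
    ∃ D : Set ℝ, D.Finite ∧ D ⊆ Set.Ioo (0 : ℝ) 4 ∧
      ∀ Δ₀ : Set ℝ, Δ₀.OrdConnected → closure Δ₀ ⊆ Set.Ioo (0 : ℝ) 4 \ D →
        ∃ δ₀ : ℝ, 0 < δ₀ ∧
          (∀ z : ℂ, z.re ∈ Δ₀ → z.im ∈ Set.Ioo (-δ₀) 0 ∪ Set.Ioo 0 δ₀ →
            z ∉ spectrum ℂ (DiscreteSchrodinger.H V)) ∧
          ∀ φ ψ : DiscreteSchrodinger.L2Z,
            DiscreteSchrodinger.IsAnalyticVector DiscreteSchrodinger.A₀ φ →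
            DiscreteSchrodinger.IsAnalyticVector DiscreteSchrodinger.A₀ ψ →
            (∃ M : ℝ, ∀ z : ℂ, z.re ∈ Δ₀ → z.im ∈ Set.Ioo (-δ₀) 0 →
              ‖inner ℂ φ (resolvent (DiscreteSchrodinger.H V) z ψ)‖ ≤ M) ∧
            (∃ M : ℝ, ∀ z : ℂ, z.re ∈ Δ₀ → z.im ∈ Set.Ioo 0 δ₀ →
              ‖inner ℂ φ (resolvent (DiscreteSchrodinger.H V) z ψ)‖ ≤ M) := by
  obtain ⟨s, hs0, hs1, k, hk, rfl⟩ := hV.exists_factorization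
  obtain ⟨d, hd, hd0, hdu⟩ := exists_determinant hs0 hs1 hk
  set K := kernelOp k
  have hs1' : 1 < s⁻¹ := (one_lt_inv₀ hs0).2 hs1
  have hq0 : 0 ≤ s ^ 2 := by positivity
  have hq1 : s ^ 2 < 1 := pow_lt_one₀ hs0.le hs1 two_ne_zero
  have hZ : {w ∈ Metric.closedBall (0 : ℂ) 1 | d w = 0}.Finite :=
    finite_zeros_closedBall zero_le_one hs1' hd hd0
  set Z := {w ∈ Metric.closedBall (0 : ℂ) 1 | d w = 0}
  have hfin : (discreteSpectrum (H (weight (s ^ 2) * K * weight (s ^ 2)))).Finite := by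
    refine (hZ.image joukowski).subset fun z hz => ?_
    obtain ⟨w, h0, h1, rfl⟩ := exists_joukowski_eq z
    -- on the circle the point lies in `[0, 4]` and is not isolated; inside, `d` has to vanish
    rcases h1.eq_or_lt with h1 | h1
    · rw [joukowski_eq_of_norm_eq_one h1] at hz
      exact absurd hz (notMem_discreteSpectrum_of_mem_Icc
        (fun x hx => Icc_subset_spectrum_H hq0 hq1 K hx) (joukowski_re_mem_Icc h1))
    · refine ⟨w, ⟨mem_closedBall_zero_iff.2 h1.le, ?_⟩, rfl⟩
      by_contra hdw
      exact (resolvent_H_eq hs0 hs1 K h0 h1 (hdu w (mem_ball_zero_iff.2 (h1.trans hs1'))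
        (one_sub_sq_ne_zero h1) hdw)).1 hz.1
  refine ⟨fun x _ hx => ?_, hfin, (fun w : ℂ => 2 - 2 * w.re) '' Z ∩ Set.Ioo 0 4,
    (hZ.image _).inter_of_left _, Set.inter_subset_right, fun Δ₀ _ hΔ => ?_⟩
  · exact Set.Infinite.of_accPt hx hfin
  have hΔ4 : closure Δ₀ ⊆ Set.Ioo 0 4 := fun x hx => (hΔ hx).1
  have hΔc : IsCompact (closure Δ₀) :=
    isCompact_Icc.of_isClosed_subset isClosed_closure (hΔ4.trans Set.Ioo_subset_Icc_self)
  obtain ⟨a, b, ha, hb, hab⟩ := exists_Icc_of_isCompact_subset_Ioo hΔc four_pos hΔ4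
  obtain ⟨t, ht0, ht1, B, hB⟩ := exists_uniform_bound_inverse hs0 hs1 K isClosed_closure hΔ4
    fun w hw hre hsq => by
      refine hdu w (mem_ball_zero_iff.2 (hw.trans_lt hs1')) hsq fun hdw => (hΔ hre).2 ?_
      exact ⟨⟨w, ⟨mem_closedBall_zero_iff.2 hw.le, hdw⟩, rfl⟩, hΔ4 hre⟩
  have key : ∀ z : ℂ, z.re ∈ Δ₀ → z.im ≠ 0 → |z.im| < t → ∃ w : ℂ, w ≠ 0 ∧ ‖w‖ < 1 ∧
      joukowski w = z ∧ w ∈ diskStrip (closure Δ₀) t := by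
    intro z hre him him1
    obtain ⟨w, h0, h1, rfl⟩ := exists_joukowski_eq z
    refine ⟨w, h0, lt_of_le_of_ne h1 fun h => him ?_, rfl,
      mem_diskStrip hΔ4 ht1 h0 h1 (subset_closure hre) him1.le⟩
    rw [joukowski_eq_of_norm_eq_one h, Complex.ofReal_im]
  have him : ∀ z : ℂ, z.im ∈ Set.Ioo (-t) 0 ∪ Set.Ioo 0 t → z.im ≠ 0 ∧ |z.im| < t := by
    rintro z (h | h)
    · exact ⟨h.2.ne, abs_lt.2 ⟨h.1, h.2.trans ht0⟩⟩
    · exact ⟨h.1.ne', abs_lt.2 ⟨(neg_lt_zero.2 ht0).trans h.1, h.2⟩⟩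
  refine ⟨t, ht0, fun z hre hz => ?_, fun φ ψ hφ hψ => ?_⟩
  · obtain ⟨w, h0, h1, rfl, hw⟩ := key z hre (him z hz).1 (him z hz).2
    exact (resolvent_H_eq hs0 hs1 K h0 h1 (hB w hw).1).1
  · obtain ⟨u, rfl, hu, _⟩ := hφ
    obtain ⟨v, rfl, hv, _⟩ := hψ
    obtain ⟨M, hM⟩ := norm_inner_resolvent_H_le hs0 hs1 K ha hb B (hu 0) (hu 1) (hv 0) (hv 1)
    have hbound : ∀ z : ℂ, z.re ∈ Δ₀ → z.im ∈ Set.Ioo (-t) 0 ∪ Set.Ioo 0 t →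
        ‖inner ℂ (u 0) (resolvent (H (weight (s ^ 2) * K * weight (s ^ 2))) z (v 0))‖ ≤ M := by
      intro z hre hz
      obtain ⟨w, h0, h1, rfl, hw⟩ := key z hre (him z hz).1 (him z hz).2
      exact hM w h0 h1 (hab (subset_closure hre)) (him _ hz).1 ((him _ hz).2.le.trans ht1)
        (hB w hw).1 (hB w hw).2
    exact ⟨⟨M, fun z hre hz => hbound z hre (Or.inl hz)⟩,
      ⟨M, fun z hre hz => hbound z hre (Or.inr hz)⟩⟩
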